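/- Let $m\ge 1$ be an integer, $n=2m$, $\sigma>0$, $x=(x_t)_{t\in\mathbb Z}$ a (deterministic) complex sequence, and suppose that one observes $y_\tau=x_\tau+\sigma\zeta_\tau$, $-n\le\tau\le n$, where the $\zeta_\tau$ are i.i.d. standard complex Gaussian ($\zeta_\tau=\xi^1_\tau+i\,\xi^2_\tau$ with $\xi^1_\tau,\xi^2_\tau$ independent $\mathcal N(0,1)$). Write $[u*v]_t=\sum_{\tau\in\mathbb Z} u_\tau v_{t-\tau}$, $[\Delta x]_t=x_{t-1}$, $\|x\|_{n,2}=\big(\sum_{t=0}^n|x_t|^2\big)^{1/2}$, and $$\|x\|_{n,1}^*=\sum_{k=0}^n\Big|\tfrac1{\sqrt{n+1}}\sum_{t=0}^n x_te^{2\pi i kt/(n+1)}\Big| .$$ For $\overline\varrho>0$, the constrained recovery is $\widehat x_{\rm con}=\widehat\varphi*y$ on $[0,n]$, where $\widehat\varphi$ is any optimal solution of $$\min\big\{\|y-\varphi*y\|_{n,2}\;:\;\varphi \text{ supported on } [0,n],\ \|\varphi\|^*_{n,1}\le\overline\varrho/\sqrt{n+1}\big\}.$$ Let $\rho\ge1$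 and assume that $x$ is $(m,\rho)$-simple: there is a nonrandom filter $\phi^o$ supported on $[0,m]$ such that $\big(\mathbf E|x_\tau-[\phi^o*y]_\tau|^2\big)^{1/2}\le\sigma\rho/\sqrt{m+1}$ for all integers $-m\le\tau\le 2m$. Let $\overline\varrho\ge2\rho^2$. Assume also (Assumption A), for an integer $1\le s\le n+1$ and a real $\varkappa$, that $x=x^{\mathcal S}+\varepsilon$ with $x^{\mathcal S}\in\mathcal S$, where $\mathcal S\subset\mathbb C^{\mathbb Z}$ is a linear subspace of dimension $s$ with $\Delta\mathcal S=\mathcal S$, and $\|\Delta^\tau\varepsilon\|_{n,2}\le\sigma\varkappa$ for $0\le\tau\le n$. Then for every $0<\alpha\le1$, with probability at least $1-\alpha$, $$\|x-\widehat x_{\rm con}\|_{n,2}\le C\sigma\rho^2\sqrt{1+\ln(1/\alpha)}+C'\sigma\sqrt{s+\overline\varrho\big(\varkappa\sqrt{1+\ln(1/\alpha)}+\ln(n/\alpha)\big)},$$ where $C,C'>0$ are absolute constants (independent of $m,\sigma,x,\rho,\overline\varrho,s,\varkappa,\alpha$). -/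

import Mathlib

open MeasureTheory ProbabilityTheory

noncomputable section

namespace FilterRecovery

/-- The space of two-sided complex sequences. -/
abbrev Signal := ℤ → ℂ

/-- The right shift `[Δ x]_t = x_{t-1}` as a linear operator. -/
def shift : Signal →ₗ[ℂ] Signal where
  toFun x := fun t => x (t - 1)
  map_add' _ _ := rfl
  map_smul' _ _ := rfl

/-- `φ` is a filter supported on `[0, n]`. -/
def SupportedOn (n : ℕ) (φ : Signal) : Prop :=
  ∀ t : ℤ, t ∉ Set.Icc (0 : ℤ) n → φ t = 0

/-- Convolution `[u * v]_t = ∑_τ u_τ v_{t-τ}`. It is only used below with a finitely supported `u`,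
so that the sum is finite. -/
def conv (u v : Signal) : Signal :=
  fun t => ∑' τ : ℤ, u τ * v (t - τ)

/-- `‖x‖_{n,2}`, the Euclidean norm of `(x_0, ..., x_n)`. -/
def l2Norm (n : ℕ) (x : Signal) : ℝ :=
  Real.sqrt (∑ t ∈ Finset.range (n + 1), ‖x (t : ℤ)‖ ^ 2)

/-- The `k`-th coefficient of the unitary discrete Fourier transform of `(x_0, ..., x_n)`. -/
def dft (n : ℕ) (x : Signal) (k : ℕ) : ℂ :=
  ((Real.sqrt ((n : ℝ) + 1))⁻¹ : ℝ) *
    ∑ t ∈ Finset.range (n + 1),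
      x (t : ℤ) * Complex.exp (2 * Real.pi * Complex.I * k * t / ((n : ℂ) + 1))

/-- The spectral norm `‖x‖*_{n,1}`: the `ℓ₁` norm of the discrete Fourier transform. -/
def specL1 (n : ℕ) (x : Signal) : ℝ :=
  ∑ k ∈ Finset.range (n + 1), ‖dft n x k‖

/-- The law of `ξ¹ + i ξ²` with `ξ¹, ξ²` independent real standard Gaussians. -/
def stdComplexGaussian : Measure ℂ :=
  ((gaussianReal 0 1).prod (gaussianReal 0 1)).map
    (fun p : ℝ × ℝ => (p.1 : ℂ) + (p.2 : ℂ) * Complex.I)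

/-- The noise variables `ζ_τ`, `-n ≤ τ ≤ n`, are i.i.d. standard complex Gaussian.
Nothing is assumed about `ζ_τ` for the other `τ`. -/
structure IsNoise {Ω : Type*} [MeasurableSpace Ω] (P : Measure Ω) (n : ℕ)
    (ζ : ℤ → Ω → ℂ) : Prop where
  law : ∀ τ ∈ Set.Icc (-(n : ℤ)) n, HasLaw (ζ τ) stdComplexGaussian P
  indep : iIndepFun (fun τ : Set.Icc (-(n : ℤ)) n => ζ τ) P

/-- The observations `y_τ = x_τ + σ ζ_τ` at the outcome `ω`. Only those with `-n ≤ τ ≤ n` enter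
the theorem. -/
def obs {Ω : Type*} (σ : ℝ) (x : Signal) (ζ : ℤ → Ω → ℂ) (ω : Ω) : Signal :=
  fun τ => x τ + (σ : ℂ) * ζ τ ω

/-- `x` is `(m, ρ)`-simple: one (nonrandom) filter supported on `[0, m]` recovers `x_τ` with
root mean square error at most `σ ρ / √(m+1)`, for every `τ` in `[-m, 2m]`. -/
def IsSimpleSignal {Ω : Type*} [MeasurableSpace Ω] (P : Measure Ω) (σ : ℝ) (ζ : ℤ → Ω → ℂ)
    (m : ℕ) (ρ : ℝ) (x : Signal) : Prop :=
  ∃ φ : Signal, SupportedOn m φ ∧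
    ∀ τ ∈ Set.Icc (-(m : ℤ)) (2 * m),
      Real.sqrt (∫ ω, ‖x τ - conv φ (obs σ x ζ ω) τ‖ ^ 2 ∂P) ≤ σ * ρ / Real.sqrt ((m : ℝ) + 1)

/-- `x` is close to a shift-invariant subspace of dimension `s`. -/
def AssumptionA (n : ℕ) (σ : ℝ) (s : ℕ) (ϰ : ℝ) (x : Signal) : Prop :=
  1 ≤ s ∧ s ≤ n + 1 ∧
  ∃ S : Submodule ℂ Signal, S.map shift = S ∧ Module.finrank ℂ S = s ∧
    ∃ xS ε : Signal, xS ∈ S ∧ x = xS + ε ∧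
      ∀ τ : ℕ, τ ≤ n → l2Norm n ((shift ^ τ) ε) ≤ σ * ϰ

/-- Feasible filters of the constrained problem: `φ` is supported on `[0, n]` and
`‖φ‖*_{n,1} ≤ r / √(n+1)`. -/
def feasible (n : ℕ) (r : ℝ) : Set Signal :=
  {φ | SupportedOn n φ ∧ specL1 n φ ≤ r / Real.sqrt ((n : ℝ) + 1)}

/-- `φ` is an optimal solution of
`min { ‖y - φ * y‖_{n,2} : φ ∈ feasible n r }` for the data `y`. -/
def IsConstrainedFilter (n : ℕ) (r : ℝ) (y φ : Signal) : Prop :=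
  φ ∈ feasible n r ∧ IsMinOn (fun ψ => l2Norm n (y - conv ψ y)) (feasible n r) φ

end FilterRecovery

end

/-! Let `u = x - φ * y` be the residual of an optimal filter and `u₀` that of the oracle `φ₀ = φᵒ *
φᵒ`, with norms and inner products over `[0, n]`. As `φ₀` is feasible, `‖u + σζ‖ ≤ ‖u₀ + σζ‖`, so
`‖u‖² ≤ ‖u₀‖² + 2σ(|⟨ζ, u⟩| + |⟨ζ, u₀⟩|)`. The optimal filter depends on the noise; what is needed
is therefore a bound `|⟨ζ, u⟩| ≤ A‖u‖ + R` valid for all feasible filters at once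
(`IsRegularNoise.norm_inner_residual_le`). Completing squares then gives `‖u‖ ≤ ‖u₀‖ + 2σA + 2√(σR)`
(`norm_le_of_residual_le`).

Oracle: bias and variance of `φᵒ` are both controlled by simplicity. Squaring the filter turns the
`ℓ₁` norm of its spectrum into the energy of `φᵒ`, which makes `φ₀` feasible, while the identity `1
- φ² = (1 - φ) + φ(1 - φ)` keeps the bias small (`oracle_filter`).

Uniform bound: let `V`, of dimension at most `s`, be the restriction of the shift-invariant space to
the window. The projection of `ζ` onto `V` gives `A`, of order `√(s + log(1/α))`. The complementary
part `q` annihilates the contribution of `xS - ψ * xS`, leaving `ε`, `ψ * ε` and `σψ * ζ`. The last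
one is quadratic in the noise and is the crux. It is linear in `ψ`, so expanding `ψ` in Fourier
modes reduces it to `n + 1` Toeplitz forms weighted by the spectrum. A Toeplitz form splits into two
triangular ones, and a triangular form is dominated by the energies of sums over dyadic blocks
(`norm_toeplitz_sum_le`). These energies are squared norms of Gaussian vectors, so `q` and `ζ` need
no decoupling. About `log n` scales cost `O(n log(n/α))` in total (`measure_dyadicEnergy_gt`), and
the spectral constraint turns this into `O(r log(n/α))`. -/

namespace FilterRecovery

open scoped ENNReal

/-! ### Exponential moments and tails of Gaussian quadratic forms -/

section Gaussian

variable {ι κ : Type*} [Fintype ι] [Fintype κ]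

lemma measurable_toComplex : Measurable (fun p : ℝ × ℝ => (p.1 : ℂ) + (p.2 : ℂ) * Complex.I) := by
  fun_prop

instance : IsProbabilityMeasure stdComplexGaussian :=
  Measure.isProbabilityMeasure_map measurable_toComplex.aemeasurable

lemma lintegral_stdComplexGaussian_mul {f g : ℝ → ℝ≥0∞} (hf : Measurable f) (hg : Measurable g) :
    ∫⁻ z, f z.re * g z.im ∂stdComplexGaussian =
      (∫⁻ x, f x ∂gaussianReal 0 1) * ∫⁻ x, g x ∂gaussianReal 0 1 := by
  rw [stdComplexGaussian, lintegral_map (by fun_prop) measurable_toComplex]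
  simp only [Complex.add_re, Complex.ofReal_re, Complex.mul_re, Complex.I_re, mul_zero,
    Complex.ofReal_im, Complex.I_im, mul_one, sub_self, add_zero, Complex.add_im, Complex.mul_im,
    zero_add]
  exact lintegral_prod_mul hf.aemeasurable hg.aemeasurable

lemma lintegral_exp_mul_gaussianReal (a : ℝ) :
    ∫⁻ x, ENNReal.ofReal (Real.exp (a * x)) ∂gaussianReal 0 1 =
      ENNReal.ofReal (Real.exp (a ^ 2 / 2)) := by
  rw [← ofReal_integral_eq_lintegral_ofReal (integrable_exp_mul_gaussianReal a)
    (Filter.Eventually.of_forall fun x => (Real.exp_pos _).le)]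
  have := mgf_gaussianReal (p := gaussianReal 0 1) (X := id) (μ := 0) (v := 1) (by simp) a
  simp only [mgf, id] at this
  rw [this]
  simp

lemma lintegral_exp_sq_gaussianReal :
    ∫⁻ x, ENNReal.ofReal (Real.exp (x ^ 2 / 4)) ∂gaussianReal 0 1 = ENNReal.ofReal (√2) := by
  rw [gaussianReal_of_var_ne_zero _ one_ne_zero,
    lintegral_withDensity_eq_lintegral_mul _ (measurable_gaussianPDF 0 1) (by fun_prop)]
  have h : ∀ x : ℝ, (gaussianPDF 0 1 * fun x => ENNReal.ofReal (Real.exp (x ^ 2 / 4))) x =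
      ENNReal.ofReal ((√(2 * Real.pi))⁻¹ * Real.exp (-(1 / 4) * x ^ 2)) := by
    intro x
    simp only [Pi.mul_apply, gaussianPDF, gaussianPDFReal]
    rw [← ENNReal.ofReal_mul (by positivity), mul_assoc, ← Real.exp_add]
    congr 3
    · simp
    · simp; ring
  simp_rw [h]
  rw [← ofReal_integral_eq_lintegral_ofReal
    ((integrable_exp_neg_mul_sq (by norm_num)).const_mul _)
    (Filter.Eventually.of_forall fun x => by positivity), integral_const_mul, integral_gaussian]
  congr 1
  rw [← Real.sqrt_inv, ← Real.sqrt_mul (by positivity)]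
  congr 1
  field_simp
  norm_num

lemma lintegral_exp_re_mul_stdComplexGaussian (w : ℂ) :
    ∫⁻ z, ENNReal.ofReal (Real.exp (w * z).re) ∂stdComplexGaussian =
      ENNReal.ofReal (Real.exp (‖w‖ ^ 2 / 2)) := by
  have h : ∀ z : ℂ, ENNReal.ofReal (Real.exp (w * z).re) =
      ENNReal.ofReal (Real.exp (w.re * z.re)) * ENNReal.ofReal (Real.exp (-w.im * z.im)) := by
    intro z
    rw [← ENNReal.ofReal_mul (Real.exp_pos _).le, ← Real.exp_add]
    simp [Complex.mul_re, sub_eq_add_neg]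
  simp_rw [h]
  rw [lintegral_stdComplexGaussian_mul (f := fun x => ENNReal.ofReal (Real.exp (w.re * x)))
    (g := fun x => ENNReal.ofReal (Real.exp (-w.im * x))) (by fun_prop) (by fun_prop),
    lintegral_exp_mul_gaussianReal, lintegral_exp_mul_gaussianReal,
    ← ENNReal.ofReal_mul (Real.exp_pos _).le, ← Real.exp_add, Complex.sq_norm,
    Complex.normSq_apply]
  congr 2
  ring

/-- The rate `1/4` is half the critical one and gives the convenient value `√2 · √2`; this is the
source of every `log 2` per dimension below. -/
lemma lintegral_exp_normSq_stdComplexGaussian :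
    ∫⁻ z, ENNReal.ofReal (Real.exp (‖z‖ ^ 2 / 4)) ∂stdComplexGaussian = 2 := by
  have h : ∀ z : ℂ, ENNReal.ofReal (Real.exp (‖z‖ ^ 2 / 4)) =
      ENNReal.ofReal (Real.exp (z.re ^ 2 / 4)) * ENNReal.ofReal (Real.exp (z.im ^ 2 / 4)) := by
    intro z
    rw [← ENNReal.ofReal_mul (Real.exp_pos _).le, ← Real.exp_add, Complex.sq_norm,
      Complex.normSq_apply]
    congr 2
    ring
  simp_rw [h]
  rw [lintegral_stdComplexGaussian_mul (f := fun x => ENNReal.ofReal (Real.exp (x ^ 2 / 4)))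
    (g := fun x => ENNReal.ofReal (Real.exp (x ^ 2 / 4))) (by fun_prop) (by fun_prop),
    lintegral_exp_sq_gaussianReal, ← ENNReal.ofReal_mul (by positivity),
    Real.mul_self_sqrt (by norm_num)]
  simp

/-- The law of a vector with i.i.d. standard complex Gaussian entries. -/
noncomputable abbrev gaussianVec (ι : Type*) [Fintype ι] : Measure (ι → ℂ) :=
  Measure.pi fun _ : ι => stdComplexGaussian

lemma lintegral_gaussianVec_prod (f : ι → ℂ → ℝ≥0∞) (hf : ∀ i, Measurable (f i)) :
    ∫⁻ z, ∏ i, f i (z i) ∂gaussianVec ι = ∏ i, ∫⁻ z, f i z ∂stdComplexGaussian := by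
  rw [lintegral_prod_eq_prod_lintegral_of_indepFun Finset.univ (fun i (z : ι → ℂ) => f i (z i))
    (iIndepFun_pi fun i => (hf i).aemeasurable) fun i => (hf i).comp (measurable_pi_apply i)]
  refine Finset.prod_congr rfl fun i _ => ?_
  exact (measurePreserving_eval (fun _ : ι => stdComplexGaussian) i).lintegral_comp (hf i)

lemma lintegral_exp_re_sum (w : ι → ℂ) :
    ∫⁻ z, ENNReal.ofReal (Real.exp (∑ i, w i * z i).re) ∂gaussianVec ι =
      ENNReal.ofReal (Real.exp ((∑ i, ‖w i‖ ^ 2) / 2)) := by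
  have h : ∀ z : ι → ℂ, ENNReal.ofReal (Real.exp (∑ i, w i * z i).re) =
      ∏ i, ENNReal.ofReal (Real.exp (w i * z i).re) := by
    intro z
    rw [Complex.re_sum, Real.exp_sum, ENNReal.ofReal_prod_of_nonneg fun i _ => (Real.exp_pos _).le]
  simp_rw [h]
  rw [lintegral_gaussianVec_prod (fun i z => ENNReal.ofReal (Real.exp (w i * z).re))
    fun i => by fun_prop]
  simp_rw [lintegral_exp_re_mul_stdComplexGaussian]
  rw [← ENNReal.ofReal_prod_of_nonneg fun i _ => (Real.exp_pos _).le, ← Real.exp_sum,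
    Finset.sum_div]

lemma lintegral_exp_sum_normSq :
    ∫⁻ z, ENNReal.ofReal (Real.exp ((∑ i, ‖z i‖ ^ 2) / 4)) ∂gaussianVec ι =
      2 ^ Fintype.card ι := by
  have h : ∀ z : ι → ℂ, ENNReal.ofReal (Real.exp ((∑ i, ‖z i‖ ^ 2) / 4)) =
      ∏ i, ENNReal.ofReal (Real.exp (‖z i‖ ^ 2 / 4)) := by
    intro z
    rw [Finset.sum_div, Real.exp_sum, ENNReal.ofReal_prod_of_nonneg fun i _ => (Real.exp_pos _).le]
  simp_rw [h]
  rw [lintegral_gaussianVec_prod (fun i z => ENNReal.ofReal (Real.exp (‖z‖ ^ 2 / 4)))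
    fun i => by fun_prop]
  simp_rw [lintegral_exp_normSq_stdComplexGaussian]
  simp

/-- The linear form `∑ conj (v i) * z i` of a vector of `ℂ`-valued observations. -/
noncomputable def form (v : EuclideanSpace ℂ ι) (z : ι → ℂ) : ℂ := inner ℂ v (WithLp.toLp 2 z)

lemma form_eq (v : EuclideanSpace ℂ ι) (z : ι → ℂ) :
    form v z = ∑ i, (starRingEnd ℂ) (v i) * z i := by
  simp [form, PiLp.inner_apply, mul_comm]

@[fun_prop]
lemma measurable_form (v : EuclideanSpace ℂ ι) : Measurable (form v) := by
  simp_rw [funext (form_eq v)]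
  fun_prop

@[fun_prop]
lemma measurable_form_right (f : κ → EuclideanSpace ℂ ι) :
    Measurable fun p : (ι → ℂ) × (κ → ℂ) => ∑ i, p.2 i * form (f i) p.1 := by
  simp_rw [form_eq]
  fun_prop

/-- The exponential of a squared modulus is the Laplace transform of an auxiliary Gaussian `g`.
After exchanging the integrals, only the norm of `∑ g j • v j` matters, so the Gram matrix need not
be diagonalized. -/
lemma lintegral_exp_sum_form_sq (v : κ → EuclideanSpace ℂ ι) {c : ℝ} (hc : 0 < c)
    (hv : ∀ g : κ → ℂ, ‖∑ j, g j • v j‖ ^ 2 ≤ c * ∑ j, ‖g j‖ ^ 2) :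
    ∫⁻ z, ENNReal.ofReal (Real.exp ((∑ j, ‖form (v j) z‖ ^ 2) / (4 * c))) ∂gaussianVec ι ≤
      2 ^ Fintype.card κ := by
  -- With `b² = 1/(2c)`, averaging over `g` produces the rate `1/(4c)`, while averaging over `z`
  -- leaves exactly the integrable rate `1/4` for `g`.
  set b : ℝ := √(2 * c)⁻¹ with hb
  have hb2 : b ^ 2 = (2 * c)⁻¹ := Real.sq_sqrt (by positivity)
  have h1 : ∀ z : ι → ℂ,
      ENNReal.ofReal (Real.exp ((∑ j, ‖form (v j) z‖ ^ 2) / (4 * c))) =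
      ∫⁻ g, ENNReal.ofReal (Real.exp (b * ∑ j, g j * form (v j) z : ℂ).re) ∂gaussianVec κ := by
    intro z
    have : ∀ g : κ → ℂ, (b * ∑ j, g j * form (v j) z : ℂ) =
        ∑ j, (b * form (v j) z) * g j := by
      intro g
      rw [Finset.mul_sum]
      exact Finset.sum_congr rfl fun j _ => by ring
    simp_rw [this]
    rw [lintegral_exp_re_sum]
    simp_rw [norm_mul, mul_pow, Complex.norm_real, Real.norm_eq_abs, sq_abs, hb2]
    rw [← Finset.mul_sum]
    congr 2
    field_simp
    ring
  have h2 : ∀ g : κ → ℂ,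
      ∫⁻ z, ENNReal.ofReal (Real.exp (b * ∑ j, g j * form (v j) z : ℂ).re) ∂gaussianVec ι ≤
      ENNReal.ofReal (Real.exp ((∑ j, ‖g j‖ ^ 2) / 4)) := by
    intro g
    have : ∀ z : ι → ℂ, (b * ∑ j, g j * form (v j) z : ℂ) =
        ∑ i, (b * (starRingEnd ℂ) ((∑ j, (starRingEnd ℂ) (g j) • v j) i)) * z i := by
      intro z
      have h3 : ∑ j, g j * form (v j) z = form (∑ j, (starRingEnd ℂ) (g j) • v j) z := by
        simp [form, mul_comm]
      rw [h3, form_eq, Finset.mul_sum]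
      exact Finset.sum_congr rfl fun j _ => by ring
    simp_rw [this]
    rw [lintegral_exp_re_sum]
    simp_rw [norm_mul, mul_pow, Complex.norm_real, Real.norm_eq_abs, sq_abs, hb2, RCLike.norm_conj]
    rw [← Finset.mul_sum, ← EuclideanSpace.norm_sq_eq]
    refine ENNReal.ofReal_le_ofReal (Real.exp_le_exp.2 ?_)
    have := hv fun j => (starRingEnd ℂ) (g j)
    simp only [RCLike.norm_conj] at this
    calc (2 * c)⁻¹ * ‖∑ j, (starRingEnd ℂ) (g j) • v j‖ ^ 2 / 2
        ≤ (2 * c)⁻¹ * (c * ∑ j, ‖g j‖ ^ 2) / 2 := by gcongr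
      _ = _ := by field_simp; ring
  calc _ = ∫⁻ z, ∫⁻ g, ENNReal.ofReal (Real.exp (b * ∑ j, g j * form (v j) z : ℂ).re)
        ∂gaussianVec κ ∂gaussianVec ι := lintegral_congr h1
    _ = ∫⁻ g, ∫⁻ z, ENNReal.ofReal (Real.exp (b * ∑ j, g j * form (v j) z : ℂ).re)
        ∂gaussianVec ι ∂gaussianVec κ := by
      refine lintegral_lintegral_swap (Measurable.aemeasurable ?_)
      have := measurable_form_right v
      simp only [Function.uncurry_def]
      fun_prop
    _ ≤ ∫⁻ g, ENNReal.ofReal (Real.exp ((∑ j, ‖g j‖ ^ 2) / 4)) ∂gaussianVec κ :=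
      lintegral_mono h2
    _ = _ := lintegral_exp_sum_normSq

/-- Exponential Markov inequality. -/
lemma measure_lt_of_lintegral_exp_le {Ω : Type*} [MeasurableSpace Ω] (μ : Measure Ω)
    {Y : Ω → ℝ} (hY : Measurable Y) {a : ℝ} (h : ∫⁻ ω, ENNReal.ofReal (Real.exp (Y ω)) ∂μ ≤
      ENNReal.ofReal (Real.exp a)) {δ : ℝ} (hδ : 0 < δ) :
    μ {ω | a + Real.log (1 / δ) < Y ω} ≤ ENNReal.ofReal δ := by
  calc μ {ω | a + Real.log (1 / δ) < Y ω}
      ≤ μ {ω | ENNReal.ofReal (Real.exp a / δ) ≤ ENNReal.ofReal (Real.exp (Y ω))} := by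
        refine measure_mono fun ω hω => ENNReal.ofReal_le_ofReal ?_
        rw [Set.mem_ofPred_eq] at hω
        have := Real.exp_le_exp.2 hω.le
        rwa [Real.exp_add, Real.exp_log (by positivity), mul_one_div] at this
    _ ≤ (∫⁻ ω, ENNReal.ofReal (Real.exp (Y ω)) ∂μ) / ENNReal.ofReal (Real.exp a / δ) :=
        meas_ge_le_lintegral_div (by fun_prop)
          (by simpa using div_pos (Real.exp_pos a) hδ) ENNReal.ofReal_ne_top
    _ ≤ ENNReal.ofReal (Real.exp a) / ENNReal.ofReal (Real.exp a / δ) := by gcongr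
    _ = ENNReal.ofReal δ := by
        rw [← ENNReal.ofReal_div_of_pos (by positivity)]
        congr 1
        field_simp

lemma two_pow_eq_ofReal_exp (d : ℕ) :
    (2 : ℝ≥0∞) ^ d = ENNReal.ofReal (Real.exp (d * Real.log 2)) := by
  rw [mul_comm, ← Real.rpow_def_of_pos (by norm_num), Real.rpow_natCast,
    ENNReal.ofReal_pow (by norm_num)]
  simp

/-- Tail bound for the squared norm of a Gaussian vector with covariance at most `2 c I`. -/
lemma measure_sum_form_sq_gt (v : κ → EuclideanSpace ℂ ι) {c : ℝ} (hc : 0 < c)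
    (hv : ∀ g : κ → ℂ, ‖∑ j, g j • v j‖ ^ 2 ≤ c * ∑ j, ‖g j‖ ^ 2) {δ : ℝ} (hδ : 0 < δ) :
    gaussianVec ι {z | 4 * c * (Fintype.card κ * Real.log 2 + Real.log (1 / δ)) <
      ∑ j, ‖form (v j) z‖ ^ 2} ≤ ENNReal.ofReal δ := by
  have h := lintegral_exp_sum_form_sq v hc hv
  rw [two_pow_eq_ofReal_exp] at h
  refine le_trans (measure_mono fun z hz => ?_) (measure_lt_of_lintegral_exp_le _
    (Y := fun z => (∑ j, ‖form (v j) z‖ ^ 2) / (4 * c)) (by fun_prop) h hδ)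
  rw [Set.mem_ofPred_eq] at hz ⊢
  rw [lt_div_iff₀ (by positivity)]
  linarith

/-- Tail bound for the squared norm of a possibly degenerate Gaussian vector whose coordinates
have variance at most `2 c`. -/
lemma measure_sum_form_sq_gt_of_norm_le (v : κ → EuclideanSpace ℂ ι) {c : ℝ} (hc : 0 ≤ c)
    (hv : ∀ j, ‖v j‖ ^ 2 ≤ c) {δ : ℝ} (hδ : 0 < δ) (hδ1 : δ ≤ 1) :
    gaussianVec ι {z | 4 * c * Fintype.card κ * (Real.log 2 + Real.log (1 / δ)) <
      ∑ j, ‖form (v j) z‖ ^ 2} ≤ ENNReal.ofReal δ := by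
  have hlog : 0 ≤ Real.log (1 / δ) := Real.log_nonneg (by rw [le_div_iff₀ hδ]; linarith)
  rcases hc.eq_or_lt with rfl | hc
  · have h0 : ∀ j, v j = 0 := fun j => by
      have := hv j
      simpa using le_antisymm this (by positivity)
    simp [h0, form]
  rcases isEmpty_or_nonempty κ with hκ | hκ
  · simp
  have hd : (0 : ℝ) < Fintype.card κ := by exact_mod_cast Fintype.card_pos
  have h1 : ∀ j, ∫⁻ z, ENNReal.ofReal (Real.exp (‖form (v j) z‖ ^ 2 / (4 * c))) ∂gaussianVec ι
      ≤ 2 := by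
    intro j
    have := lintegral_exp_sum_form_sq (κ := Unit) (fun _ => v j) hc (by
      intro g
      simp only [Finset.univ_unique, Finset.sum_singleton, norm_smul, mul_pow]
      rw [mul_comm]
      gcongr
      exact hv j)
    simpa using this
  -- Jensen with equal weights reduces to one coordinate at a time, so correlations are irrelevant;
  -- the price is that `log (1 / δ)` gets multiplied by the number of coordinates.
  have h : ∫⁻ z, ENNReal.ofReal (Real.exp ((∑ j, ‖form (v j) z‖ ^ 2) /
      (4 * c * Fintype.card κ))) ∂gaussianVec ι ≤ ENNReal.ofReal (Real.exp (Real.log 2)) := by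
    calc _ ≤ ∫⁻ z, ∑ j, ENNReal.ofReal ((Fintype.card κ : ℝ)⁻¹) *
          ENNReal.ofReal (Real.exp (‖form (v j) z‖ ^ 2 / (4 * c))) ∂gaussianVec ι := by
          refine lintegral_mono fun z => ?_
          simp_rw [← ENNReal.ofReal_mul (inv_nonneg.2 hd.le)]
          rw [← ENNReal.ofReal_sum_of_nonneg fun j _ => by positivity]
          refine ENNReal.ofReal_le_ofReal ?_
          have := convexOn_exp.map_sum_le (t := Finset.univ) (w := fun _ : κ =>
            (Fintype.card κ : ℝ)⁻¹) (p := fun j => ‖form (v j) z‖ ^ 2 / (4 * c))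
            (fun _ _ => by positivity) (by simp) (fun _ _ => Set.mem_univ _)
          simp only [smul_eq_mul, ← Finset.mul_sum, ← Finset.sum_div] at this ⊢
          refine le_trans (le_of_eq ?_) this
          congr 1
          field_simp
      _ = ∑ j, ENNReal.ofReal ((Fintype.card κ : ℝ)⁻¹) *
          ∫⁻ z, ENNReal.ofReal (Real.exp (‖form (v j) z‖ ^ 2 / (4 * c))) ∂gaussianVec ι := by
          rw [lintegral_finsetSum _ fun j _ => by fun_prop]
          exact Finset.sum_congr rfl fun j _ => lintegral_const_mul _ (by fun_prop)
      _ ≤ ∑ j : κ, ENNReal.ofReal ((Fintype.card κ : ℝ)⁻¹) * 2 := by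
          gcongr with j
          exact h1 j
      _ = _ := by
          rw [Real.exp_log (by norm_num), Finset.sum_const, Finset.card_univ, nsmul_eq_mul,
            ← mul_assoc, ← ENNReal.ofReal_natCast, ← ENNReal.ofReal_mul hd.le,
            mul_inv_cancel₀ hd.ne']
          simp
  refine le_trans (measure_mono fun z hz => ?_) (measure_lt_of_lintegral_exp_le _
    (Y := fun z => (∑ j, ‖form (v j) z‖ ^ 2) / (4 * c * Fintype.card κ)) (by fun_prop) h hδ)
  rw [Set.mem_ofPred_eq] at hz ⊢
  rw [lt_div_iff₀ (by positivity)]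
  linarith

end Gaussian

/-! ### Mean square of an affine form of the noise -/

section SecondMoment

variable {ι : Type*} [Fintype ι]

lemma memLp_re_mul_stdComplexGaussian (w : ℂ) :
    MemLp (fun z : ℂ => (w * z).re) 2 stdComplexGaussian := by
  rw [stdComplexGaussian, memLp_map_measure_iff (by fun_prop) (by fun_prop)]
  have h : MemLp (fun x : ℝ => x) 2 (gaussianReal 0 1) := memLp_id_gaussianReal' 2 (by simp)
  have h1 := (h.comp_measurePreserving
    (measurePreserving_fst (μ := gaussianReal 0 1) (ν := gaussianReal 0 1))).const_mul w.re
  have h2 := (h.comp_measurePreserving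
    (measurePreserving_snd (μ := gaussianReal 0 1) (ν := gaussianReal 0 1))).const_mul w.im
  refine (h1.sub h2).congr_norm (by fun_prop) (Filter.Eventually.of_forall fun p => ?_)
  simp

lemma integral_re_mul_stdComplexGaussian (w : ℂ) :
    ∫ z, (w * z).re ∂stdComplexGaussian = 0 := by
  rw [stdComplexGaussian, integral_map (by fun_prop) (by fun_prop)]
  have h : Integrable (fun x : ℝ => x) (gaussianReal 0 1) :=
    (memLp_id_gaussianReal' 1 (by simp)).integrable le_rfl
  simp only [Complex.mul_re, Complex.add_re, Complex.ofReal_re, Complex.I_re, mul_zero,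
    Complex.ofReal_im, Complex.I_im, mul_one, sub_self, add_zero, Complex.add_im, Complex.mul_im,
    zero_add]
  rw [integral_sub ((h.comp_fst _).const_mul _) ((h.comp_snd _).const_mul _),
    integral_const_mul, integral_const_mul, integral_fun_fst (fun x : ℝ => x), integral_fun_snd (fun x : ℝ => x)]
  simp

lemma variance_re_mul_stdComplexGaussian (w : ℂ) :
    Var[fun z : ℂ => (w * z).re; stdComplexGaussian] = ‖w‖ ^ 2 := by
  rw [stdComplexGaussian, variance_map (by fun_prop) (by fun_prop)]
  have h : MemLp (fun x : ℝ => x) 2 (gaussianReal 0 1) := memLp_id_gaussianReal' 2 (by simp)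
  have := variance_add_prod (h.const_mul w.re) (h.const_mul (-w.im))
  rw [variance_const_mul, variance_const_mul, variance_fun_id_gaussianReal] at this
  calc _ = _ := by
        congr 1
        ext p
        simp [sub_eq_add_neg]
    _ = _ := this
    _ = _ := by
        rw [Complex.sq_norm, Complex.normSq_apply]
        simp
        ring

lemma integrable_sq_re_sum (a : ℝ) (w : ι → ℂ) :
    MemLp (fun z : ι → ℂ => a + (∑ i, w i * z i).re) 2 (gaussianVec ι) := by
  refine (memLp_const a).add ?_
  simp_rw [Complex.re_sum]
  exact memLp_finsetSum _ fun i _ => (memLp_re_mul_stdComplexGaussian (w i)).comp_measurePreserving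
    (measurePreserving_eval _ i)

lemma integral_sq_re_sum (a : ℝ) (w : ι → ℂ) :
    ∫ z, (a + (∑ i, w i * z i).re) ^ 2 ∂gaussianVec ι = a ^ 2 + ∑ i, ‖w i‖ ^ 2 := by
  have hm := integrable_sq_re_sum a w
  have hint : ∫ z, (a + (∑ i, w i * z i).re) ∂gaussianVec ι = a := by
    have hi : ∀ i, Integrable (fun z : ι → ℂ => (w i * z i).re) (gaussianVec ι) := fun i =>
      ((memLp_re_mul_stdComplexGaussian (w i)).comp_measurePreserving
        (measurePreserving_eval (fun _ : ι => stdComplexGaussian) i)).integrable one_le_two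
    simp_rw [Complex.re_sum]
    rw [integral_add (integrable_const a) (integrable_finsetSum _ fun i _ => hi i),
      integral_finsetSum _ fun i _ => hi i]
    have : ∀ i, ∫ z : ι → ℂ, (w i * z i).re ∂gaussianVec ι = 0 := fun i => by
      rw [← integral_re_mul_stdComplexGaussian (w i)]
      exact integral_comp_eval (μ := fun _ : ι => stdComplexGaussian) (i := i)
        (f := fun z : ℂ => (w i * z).re) (by fun_prop)
    rw [Finset.sum_congr rfl fun i _ => this i]
    simp
  have hvar : Var[fun z : ι → ℂ => a + (∑ i, w i * z i).re; gaussianVec ι] = ∑ i, ‖w i‖ ^ 2 := by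
    rw [variance_const_add (Measurable.aestronglyMeasurable (by fun_prop))]
    have := variance_sum_pi (μ := fun _ : ι => stdComplexGaussian)
      (X := fun i z => (w i * z).re) fun i => memLp_re_mul_stdComplexGaussian (w i)
    simp_rw [variance_re_mul_stdComplexGaussian] at this
    rw [← this]
    congr 1
    ext z
    simp
  have := variance_eq_sub hm
  rw [hvar, hint] at this
  rw [this]
  simp

/-- The imaginary part is the real part after multiplication by `-i`, so the real computation
applies twice. The factor `2` reflects `E|ζ|² = 2`. -/
lemma integral_norm_sq_add_sum (a : ℂ) (w : ι → ℂ) :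
    ∫ z, ‖a + ∑ i, w i * z i‖ ^ 2 ∂gaussianVec ι = ‖a‖ ^ 2 + 2 * ∑ i, ‖w i‖ ^ 2 := by
  have h1 := integral_sq_re_sum a.re w
  have h2 := integral_sq_re_sum a.im fun i => -Complex.I * w i
  have e : ∀ z : ι → ℂ, ‖a + ∑ i, w i * z i‖ ^ 2 = (a.re + (∑ i, w i * z i).re) ^ 2 +
      (a.im + (∑ i, (-Complex.I * w i) * z i).re) ^ 2 := by
    intro z
    simp_rw [mul_assoc]
    rw [← Finset.mul_sum, Complex.sq_norm, Complex.normSq_apply]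
    simp
    ring
  simp_rw [e]
  rw [integral_add (integrable_sq_re_sum a.re w).integrable_sq
    (integrable_sq_re_sum a.im fun i => -Complex.I * w i).integrable_sq, h1, h2, Complex.sq_norm,
    Complex.normSq_apply]
  simp
  ring

end SecondMoment

/-! ### Convolution as a finite sum over observed indices -/

section Conv

/-- The indices of the observations. -/
abbrev ObsIdx (n : ℕ) : Type := Set.Icc (-(n : ℤ)) n

lemma sum_range_int {M : Type*} [AddCommMonoid M] (n : ℕ) (F : ℤ → M) :
    ∑ j ∈ Finset.range (n + 1), F j = ∑ j ∈ Finset.Icc (0 : ℤ) n, F j := by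
  refine Finset.sum_bij (fun j _ => (j : ℤ)) ?_ ?_ ?_ ?_
  · intro j hj
    simp at hj ⊢
    omega
  · intro a _ b _ h
    exact_mod_cast h
  · intro b hb
    simp at hb
    exact ⟨b.toNat, by simp; omega, by omega⟩
  · simp

lemma sum_obsIdx {M : Type*} [AddCommMonoid M] (n : ℕ) (F : ℤ → M) :
    ∑ i : ObsIdx n, F i = ∑ j ∈ Finset.Icc (-(n : ℤ)) n, F j :=
  (Finset.sum_subtype _ (by simp) F).symm

lemma sum_obsIdx_sub {M : Type*} [AddCommMonoid M] {n k : ℕ} {t : ℤ} (ht : t ≤ n)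
    (ht' : (k : ℤ) - n ≤ t) {F : ℤ → M} (hF : ∀ j, j ∉ Set.Icc (0 : ℤ) k → F j = 0) :
    ∑ i : ObsIdx n, F (t - i) = ∑ j ∈ Finset.range (k + 1), F j := by
  rw [sum_range_int, sum_obsIdx n fun i => F (t - i)]
  have : ∑ j ∈ Finset.Icc (0 : ℤ) k, F j = ∑ i ∈ Finset.Icc (t - k) t, F (t - i) := by
    refine Finset.sum_bij (fun j _ => t - j) ?_ ?_ ?_ ?_
    · intro j hj
      simp at hj ⊢
      omega
    · intro a _ b _ h
      simpa using h
    · intro b hb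
      simp at hb
      exact ⟨t - b, by simp; omega, by omega⟩
    · simp
  rw [this]
  refine (Finset.sum_subset ?_ ?_).symm
  · intro i hi
    simp at hi ⊢
    omega
  · intro i _ hi
    refine hF _ fun h => hi ?_
    simp at h ⊢
    omega

lemma conv_eq_sum {k : ℕ} {φ : Signal} (hφ : SupportedOn k φ) (v : Signal) (t : ℤ) :
    conv φ v t = ∑ j ∈ Finset.range (k + 1), φ j * v (t - j) := by
  rw [conv, sum_range_int k fun j => φ j * v (t - j)]
  refine tsum_eq_sum fun j hj => ?_
  rw [hφ j (by simpa using hj), zero_mul]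

/-- The two conditions on `t` say that every entry read, from `t - k` to `t`, is an observed one. -/
lemma conv_eq_sum_obsIdx {n k : ℕ} {φ : Signal} (hφ : SupportedOn k φ) (v : Signal) {t : ℤ}
    (ht : t ≤ n) (ht' : (k : ℤ) - n ≤ t) :
    conv φ v t = ∑ i : ObsIdx n, φ (t - i) * v i := by
  rw [conv_eq_sum hφ, ← sum_obsIdx_sub ht ht' (F := fun j => φ j * v (t - j))]
  · simp
  · intro j hj
    rw [hφ j hj, zero_mul]

lemma conv_add_right {k : ℕ} {φ : Signal} (hφ : SupportedOn k φ) (u v : Signal) :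
    conv φ (u + v) = conv φ u + conv φ v := by
  ext t
  simp [conv_eq_sum hφ, mul_add, Finset.sum_add_distrib]

lemma conv_smul_right {k : ℕ} {φ : Signal} (hφ : SupportedOn k φ) (c : ℂ) (v : Signal) :
    conv φ (c • v) = c • conv φ v := by
  ext t
  simp [conv_eq_sum hφ, Finset.mul_sum, mul_left_comm]

end Conv

/-- The noise seen as a vector. -/
lemma IsNoise.hasLaw {Ω : Type*} [MeasurableSpace Ω] {P : Measure Ω} {n : ℕ} {ζ : ℤ → Ω → ℂ}
    (h : IsNoise P n ζ) :
    HasLaw (fun ω (i : ObsIdx n) => ζ i ω) (gaussianVec (ObsIdx n)) P :=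
  h.indep.hasLaw_pi fun i => h.law i i.2

/-- The mean square error is squared bias plus the variance `2σ²‖φ‖²`, and each summand is at most
the total. The variance does not depend on `τ`, so a single time (`τ = 0`) bounds the energy of `φ`.
-/
lemma IsSimpleSignal.exists_filter {Ω : Type*} [MeasurableSpace Ω] {P : Measure Ω}
    {m n : ℕ} (hn : n = 2 * m) {ζ : ℤ → Ω → ℂ} (h : IsNoise P n ζ)
    {σ ρ : ℝ} (hσ : 0 < σ) (hρ : 0 ≤ ρ) {x : Signal} (hx : IsSimpleSignal P σ ζ m ρ x) :
    ∃ φ : Signal, SupportedOn m φ ∧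
      2 * ((m : ℝ) + 1) * l2Norm m φ ^ 2 ≤ ρ ^ 2 ∧
      ∀ τ ∈ Set.Icc (-(m : ℤ)) (2 * m),
        ‖x τ - conv φ x τ‖ ≤ σ * ρ / √((m : ℝ) + 1) := by
  obtain ⟨φ, hφ, H⟩ := hx
  have key : ∀ τ ∈ Set.Icc (-(m : ℤ)) (2 * m),
      ‖x τ - conv φ x τ‖ ^ 2 + 2 * (σ ^ 2 * l2Norm m φ ^ 2) ≤ σ ^ 2 * ρ ^ 2 / ((m : ℝ) + 1) := by
    intro τ hτ
    have h1 : τ ≤ n := by have := hτ.2; omega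
    have h2 : (m : ℤ) - n ≤ τ := by have := hτ.1; omega
    have e : ∀ ω, x τ - conv φ (obs σ x ζ ω) τ =
        (x τ - conv φ x τ) + ∑ i : ObsIdx n, (-(σ : ℂ) * φ (τ - i)) * ζ i ω := by
      intro ω
      rw [conv_eq_sum_obsIdx hφ _ h1 h2, conv_eq_sum_obsIdx hφ _ h1 h2]
      simp only [obs, mul_add, Finset.sum_add_distrib]
      rw [sub_add_eq_sub_sub, sub_eq_add_neg (x τ - _), ← Finset.sum_neg_distrib]
      congr 1
      exact Finset.sum_congr rfl fun i _ => by ring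
    have hτ' := H τ hτ
    simp_rw [e] at hτ'
    have hlaw := h.hasLaw.integral_comp (f := fun z : ObsIdx n → ℂ => ‖(x τ - conv φ x τ) +
      ∑ i : ObsIdx n, (-(σ : ℂ) * φ (τ - i)) * z i‖ ^ 2) (Measurable.aestronglyMeasurable (by fun_prop))
    simp only [Function.comp_def] at hlaw
    rw [hlaw, integral_norm_sq_add_sum] at hτ'
    have hs : ∑ i : ObsIdx n, ‖-(σ : ℂ) * φ (τ - i)‖ ^ 2 = σ ^ 2 * l2Norm m φ ^ 2 := by
      simp_rw [norm_mul, mul_pow, norm_neg, Complex.norm_real, Real.norm_eq_abs, sq_abs]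
      rw [← Finset.mul_sum, sum_obsIdx_sub h1 h2 (F := fun j => ‖φ j‖ ^ 2), l2Norm,
        Real.sq_sqrt (by positivity)]
      intro j hj
      simp [hφ j hj]
    rw [hs] at hτ'
    have := Real.sqrt_le_iff.1 hτ'
    refine this.2.trans (le_of_eq ?_)
    rw [div_pow, Real.sq_sqrt (by positivity), mul_pow]
  refine ⟨φ, hφ, ?_, fun τ hτ => ?_⟩
  · have := key 0 (by simp)
    have h3 : 2 * (σ ^ 2 * l2Norm m φ ^ 2) ≤ σ ^ 2 * ρ ^ 2 / ((m : ℝ) + 1) :=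
      le_trans (le_add_of_nonneg_left (by positivity)) this
    rw [le_div_iff₀ (by positivity)] at h3
    have hσ2 : 0 < σ ^ 2 := by positivity
    nlinarith
  · have h3 : ‖x τ - conv φ x τ‖ ^ 2 ≤ σ ^ 2 * ρ ^ 2 / ((m : ℝ) + 1) :=
      le_trans (le_add_of_nonneg_right (by positivity)) (key τ hτ)
    refine abs_le_of_sq_le_sq' ?_ (by positivity) |>.2
    rwa [div_pow, Real.sq_sqrt (by positivity), mul_pow]

/-! ### Discrete Fourier transform and the spectrum of a squared filter -/

section Dft

/-- The primitive root of unity `exp (2 π i / (n + 1))`. -/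
noncomputable def dftRoot (n : ℕ) : ℂ := Complex.exp (2 * Real.pi * Complex.I / ((n + 1 : ℕ) : ℂ))

lemma isPrimitiveRoot_dftRoot (n : ℕ) : IsPrimitiveRoot (dftRoot n) (n + 1) :=
  Complex.isPrimitiveRoot_exp _ (Nat.succ_ne_zero n)

lemma dftRoot_ne_zero (n : ℕ) : dftRoot n ≠ 0 := Complex.exp_ne_zero _

lemma norm_dftRoot (n : ℕ) : ‖dftRoot n‖ = 1 :=
  (isPrimitiveRoot_dftRoot n).norm'_eq_one (Nat.succ_ne_zero n)

lemma exp_eq_dftRoot_zpow (n k t : ℕ) :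
    Complex.exp (2 * Real.pi * Complex.I * k * t / ((n : ℂ) + 1)) =
      (dftRoot n ^ k) ^ (t : ℤ) := by
  rw [dftRoot, ← Complex.exp_nat_mul, zpow_natCast, ← Complex.exp_nat_mul]
  congr 1
  push_cast
  ring

lemma dft_eq (n : ℕ) (x : Signal) (k : ℕ) :
    dft n x k = ((√((n : ℝ) + 1))⁻¹ : ℝ) *
      ∑ t ∈ Finset.range (n + 1), x (t : ℤ) * (dftRoot n ^ k) ^ (t : ℤ) := by
  simp_rw [dft, exp_eq_dftRoot_zpow]

lemma sum_dftRoot_zpow {n t u : ℕ} (ht : t ∈ Finset.range (n + 1))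
    (hu : u ∈ Finset.range (n + 1)) :
    ∑ k ∈ Finset.range (n + 1), (dftRoot n ^ k) ^ (t : ℤ) * (dftRoot n ^ k) ^ (-(u : ℤ)) =
      if t = u then (n : ℂ) + 1 else 0 := by
  have e : ∀ k : ℕ, (dftRoot n ^ k) ^ (t : ℤ) * (dftRoot n ^ k) ^ (-(u : ℤ)) =
      (dftRoot n ^ ((t : ℤ) - u)) ^ k := by
    intro k
    rw [← zpow_add₀ (pow_ne_zero _ (dftRoot_ne_zero n)), ← zpow_natCast, ← zpow_natCast,
      ← zpow_mul, ← zpow_mul, mul_comm, sub_eq_add_neg]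
  simp_rw [e]
  split_ifs with h
  · simp [h]
  · have h1 : dftRoot n ^ ((t : ℤ) - u) ≠ 1 := by
      rw [Ne, (isPrimitiveRoot_dftRoot n).zpow_eq_one_iff_dvd]
      intro hd
      simp only [Finset.mem_range] at ht hu
      have := Int.eq_zero_of_abs_lt_dvd hd (by rw [abs_lt]; omega)
      omega
    have h2 : (dftRoot n ^ ((t : ℤ) - u)) ^ (n + 1) = 1 := by
      rw [← zpow_natCast, ← zpow_mul, mul_comm, zpow_mul, zpow_natCast,
        (isPrimitiveRoot_dftRoot n).pow_eq_one, one_zpow]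
    rw [geom_sum_eq h1, h2, sub_self, zero_div]

lemma dft_inversion {n : ℕ} (x : Signal) {t : ℕ} (ht : t ∈ Finset.range (n + 1)) :
    x t = ((√((n : ℝ) + 1))⁻¹ : ℝ) *
      ∑ k ∈ Finset.range (n + 1), dft n x k * (dftRoot n ^ k) ^ (-(t : ℤ)) := by
  simp_rw [dft_eq, mul_assoc, Finset.sum_mul, ← Finset.mul_sum]
  rw [Finset.sum_comm]
  have : ∀ u ∈ Finset.range (n + 1), ∑ k ∈ Finset.range (n + 1),
      x u * (dftRoot n ^ k) ^ (u : ℤ) * (dftRoot n ^ k) ^ (-(t : ℤ)) =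
      if t = u then x t * ((n : ℂ) + 1) else 0 := by
    intro u hu
    simp_rw [mul_assoc]
    rw [← Finset.mul_sum, sum_dftRoot_zpow hu ht]
    rcases eq_or_ne t u with rfl | h
    · simp
    · simp [h, h.symm]
  rw [Finset.sum_congr rfl this, Finset.sum_ite_eq, if_pos ht, ← mul_assoc, ← Complex.ofReal_mul,
    ← mul_inv, Real.mul_self_sqrt (by positivity)]
  have : (n : ℂ) + 1 ≠ 0 := by exact_mod_cast Nat.succ_ne_zero n
  push_cast
  field_simp

/-- Parseval, obtained by inserting the inversion formula into one factor of `conj (x t) * x t`. -/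
lemma sum_norm_dft_sq (n : ℕ) (x : Signal) :
    ∑ k ∈ Finset.range (n + 1), ‖dft n x k‖ ^ 2 = l2Norm n x ^ 2 := by
  rw [l2Norm, Real.sq_sqrt (by positivity)]
  have hc : ∀ k t : ℕ, (starRingEnd ℂ) ((dftRoot n ^ k) ^ (t : ℤ)) =
      (dftRoot n ^ k) ^ (-(t : ℤ)) := by
    intro k t
    rw [zpow_neg, Complex.inv_eq_conj (by simp [norm_dftRoot])]
  have : ∑ k ∈ Finset.range (n + 1), ((starRingEnd ℂ) (dft n x k)) * dft n x k =
      ∑ t ∈ Finset.range (n + 1), (starRingEnd ℂ) (x t) * x t := by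
    have h1 : ∀ t ∈ Finset.range (n + 1), (starRingEnd ℂ) (x t) * x t =
        ∑ k ∈ Finset.range (n + 1), ((√((n : ℝ) + 1))⁻¹ : ℝ) * ((starRingEnd ℂ) (x t) *
          (dftRoot n ^ k) ^ (-(t : ℤ))) * dft n x k := by
      intro t ht
      conv_lhs => enter [2]; rw [dft_inversion x ht]
      simp_rw [Finset.mul_sum]
      exact Finset.sum_congr rfl fun k _ => by ring
    rw [Finset.sum_congr rfl h1, Finset.sum_comm]
    refine Finset.sum_congr rfl fun k _ => ?_
    rw [← Finset.sum_mul, ← Finset.mul_sum]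
    congr 1
    rw [dft_eq]
    rw [map_mul, Complex.conj_ofReal, map_sum]
    simp_rw [map_mul, hc]
  simp_rw [Complex.conj_mul'] at this
  exact_mod_cast this

lemma l2Norm_le_specL1 (n : ℕ) (x : Signal) : l2Norm n x ≤ specL1 n x := by
  have h : 0 ≤ specL1 n x := Finset.sum_nonneg fun _ _ => norm_nonneg _
  refine abs_le_of_sq_le_sq' ?_ h |>.2
  rw [← sum_norm_dft_sq, specL1]
  exact Finset.sum_sq_le_sq_sum_of_nonneg fun _ _ => norm_nonneg _

lemma sum_range_sub {M : Type*} [AddCommMonoid M] {m i : ℕ} (hi : i ∈ Finset.range (m + 1))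
    {F : ℤ → M} (hF : ∀ j, j ∉ Set.Icc (0 : ℤ) m → F j = 0) :
    ∑ t ∈ Finset.range (2 * m + 1), F (t - i) = ∑ j ∈ Finset.range (m + 1), F j := by
  simp only [Finset.mem_range] at hi
  refine (Finset.sum_bij_ne_zero (fun j _ _ => j + i) ?_ ?_ ?_ ?_).symm
  · intro j hj _
    simp at hj ⊢
    omega
  · intro a _ _ b _ _ h
    omega
  · intro b hb hb0
    have : (b : ℤ) - i ∈ Set.Icc (0 : ℤ) m := by
      by_contra hc
      exact hb0 (hF _ hc)
    have h1 : i ≤ b := by have := this.1; omega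
    have h2 : b - i ≤ m := by have := this.2; omega
    refine ⟨b - i, by simp; omega, ?_, by omega⟩
    rwa [Nat.cast_sub h1]
  · intro j _ _
    simp

lemma supportedOn_conv_self {m : ℕ} {φ : Signal} (hφ : SupportedOn m φ) :
    SupportedOn (2 * m) (conv φ φ) := by
  intro t ht
  rw [conv_eq_sum hφ]
  refine Finset.sum_eq_zero fun j hj => ?_
  rw [hφ (t - j), mul_zero]
  simp at hj ht ⊢
  omega

lemma conv_conv_self {m : ℕ} {φ : Signal} (hφ : SupportedOn m φ) (v : Signal) :
    conv (conv φ φ) v = conv φ (conv φ v) := by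
  ext t
  rw [conv_eq_sum (supportedOn_conv_self hφ), conv_eq_sum hφ (conv φ v)]
  simp_rw [conv_eq_sum hφ, Finset.sum_mul, Finset.mul_sum]
  rw [Finset.sum_comm]
  refine Finset.sum_congr rfl fun i hi => ?_
  rw [← sum_range_sub hi (F := fun j => φ i * (φ j * v (t - i - j)))]
  · refine Finset.sum_congr rfl fun j _ => ?_
    rw [sub_sub_sub_cancel_right, mul_assoc]
  · intro j hj
    simp [hφ j hj]

/-- The square is supported on `[0, 2m]`, which is exactly one period of length `2m + 1`: there is
no wrap-around and the transform is multiplicative. -/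
lemma dft_conv_self {m : ℕ} {φ : Signal} (hφ : SupportedOn m φ) (k : ℕ) :
    dft (2 * m) (conv φ φ) k = √(((2 * m : ℕ) : ℝ) + 1) * dft (2 * m) φ k ^ 2 := by
  have hz : dftRoot (2 * m) ^ k ≠ 0 := pow_ne_zero _ (dftRoot_ne_zero _)
  have h0 : ∑ t ∈ Finset.range (2 * m + 1), φ t * (dftRoot (2 * m) ^ k) ^ (t : ℤ) =
      ∑ j ∈ Finset.range (m + 1), φ j * (dftRoot (2 * m) ^ k) ^ (j : ℤ) := by
    rw [← sum_range_sub (m := m) (i := 0) (by simp)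
      (F := fun j => φ j * (dftRoot (2 * m) ^ k) ^ j)]
    · simp
    · intro j hj
      simp [hφ j hj]
  have h1 : ∑ t ∈ Finset.range (2 * m + 1), conv φ φ t * (dftRoot (2 * m) ^ k) ^ (t : ℤ) =
      (∑ j ∈ Finset.range (m + 1), φ j * (dftRoot (2 * m) ^ k) ^ (j : ℤ)) ^ 2 := by
    simp_rw [conv_eq_sum hφ, Finset.sum_mul]
    rw [Finset.sum_comm, sq, Finset.sum_mul]
    refine Finset.sum_congr rfl fun i hi => ?_
    rw [← sum_range_sub hi (F := fun j => φ j * (dftRoot (2 * m) ^ k) ^ j), Finset.mul_sum]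
    · refine Finset.sum_congr rfl fun t _ => ?_
      rw [zpow_sub₀ hz]
      field_simp
    · intro j hj
      simp [hφ j hj]
  rw [dft_eq, dft_eq, h0, h1, mul_pow, ← mul_assoc]
  congr 1
  rw [← Complex.ofReal_pow, ← Complex.ofReal_mul]
  congr 1
  have : √(((2 * m : ℕ) : ℝ) + 1) ≠ 0 := by positivity
  field_simp

lemma l2Norm_of_supportedOn {m : ℕ} {φ : Signal} (hφ : SupportedOn m φ) :
    l2Norm (2 * m) φ = l2Norm m φ := by
  rw [l2Norm, l2Norm, ← sum_range_sub (m := m) (i := 0) (by simp) (F := fun j => ‖φ j‖ ^ 2)]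
  · simp
  · intro j hj
    simp [hφ j hj]

/-- The moduli of the transform of the square are squared moduli, so the `ℓ₁` norm becomes an energy
and Parseval applies. This is why the oracle is the square of the given filter. -/
lemma specL1_conv_self {m : ℕ} {φ : Signal} (hφ : SupportedOn m φ) :
    specL1 (2 * m) (conv φ φ) = √(((2 * m : ℕ) : ℝ) + 1) * l2Norm m φ ^ 2 := by
  rw [← l2Norm_of_supportedOn hφ, ← sum_norm_dft_sq, specL1, Finset.mul_sum]
  refine Finset.sum_congr rfl fun k _ => ?_
  rw [dft_conv_self hφ, norm_mul, norm_pow, Complex.norm_real, Real.norm_of_nonneg (by positivity)]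

end Dft

/-! ### Dyadic control of triangular and Toeplitz bilinear forms -/

section Dyadic

/-- The bilinear form of the lower triangular all-ones matrix. -/
noncomputable def triSum (M : ℕ) (a b : ℕ → ℂ) : ℂ :=
  ∑ t ∈ Finset.range M, ∑ u ∈ Finset.range (t + 1), a t * b u

/-- The energy of the sums of `a` over the `k` consecutive blocks of length `L`. -/
noncomputable def blockEnergy (L k : ℕ) (a : ℕ → ℂ) : ℝ :=
  ∑ j ∈ Finset.range k, ‖∑ i ∈ Finset.range L, a (j * L + i)‖ ^ 2

/-- The total energy of the sums of `a` over the dyadic subintervals of `[0, 2 ^ p)`. -/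
noncomputable def dyadicEnergy (p : ℕ) (a : ℕ → ℂ) : ℝ :=
  ∑ l ∈ Finset.range (p + 1), blockEnergy (2 ^ l) (2 ^ (p - l)) a

/-- Summation over consecutive pairs. -/
def pairSum (a : ℕ → ℂ) : ℕ → ℂ := fun j => a (2 * j) + a (2 * j + 1)

lemma sum_pairSum (a : ℕ → ℂ) (M : ℕ) :
    ∑ j ∈ Finset.range M, pairSum a j = ∑ t ∈ Finset.range (2 * M), a t := by
  induction M with
  | zero => simp
  | succ M ih =>
    rw [Finset.sum_range_succ, ih, mul_add_one, Finset.sum_range_succ, Finset.sum_range_succ,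
      pairSum, add_assoc]

/-- Grouping indices in pairs fills the `2 × 2` diagonal blocks completely; the only entry in excess
in each block is the one above the diagonal. -/
lemma triSum_two_mul (M : ℕ) (a b : ℕ → ℂ) :
    triSum (2 * M) a b = triSum M (pairSum a) (pairSum b) -
      ∑ j ∈ Finset.range M, a (2 * j) * b (2 * j + 1) := by
  induction M with
  | zero => simp [triSum]
  | succ M ih =>
    have e : triSum (2 * (M + 1)) a b = triSum (2 * M) a b +
        ∑ u ∈ Finset.range (2 * M + 1), a (2 * M) * b u +
        ∑ u ∈ Finset.range (2 * M + 1 + 1), a (2 * M + 1) * b u := by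
      rw [triSum, mul_add_one, Finset.sum_range_succ, Finset.sum_range_succ, triSum]
    have e' : triSum (M + 1) (pairSum a) (pairSum b) = triSum M (pairSum a) (pairSum b) +
        pairSum a M * ((∑ t ∈ Finset.range (2 * M), b t) + pairSum b M) := by
      rw [triSum, Finset.sum_range_succ, ← Finset.mul_sum, Finset.sum_range_succ _ M, sum_pairSum,
        triSum]
    rw [e, e', ih, ← Finset.mul_sum, ← Finset.mul_sum, Finset.sum_range_succ _ (2 * M + 1),
      Finset.sum_range_succ _ (2 * M), Finset.sum_range_succ _ M, pairSum, pairSum]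
    ring

lemma blockEnergy_pairSum (L k : ℕ) (a : ℕ → ℂ) :
    blockEnergy L k (pairSum a) = blockEnergy (2 * L) k a := by
  refine Finset.sum_congr rfl fun j _ => ?_
  have := sum_pairSum (fun t => a (2 * (j * L) + t)) L
  rw [← mul_assoc, mul_comm 2 j, mul_assoc] at this
  rw [← this]
  simp [pairSum, mul_add, add_assoc, mul_left_comm]

lemma dyadicEnergy_succ (p : ℕ) (a : ℕ → ℂ) :
    dyadicEnergy (p + 1) a = dyadicEnergy p (pairSum a) + ∑ j ∈ Finset.range (2 ^ (p + 1)),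
      ‖a j‖ ^ 2 := by
  rw [dyadicEnergy, Finset.sum_range_succ', dyadicEnergy]
  congr 1
  · refine Finset.sum_congr rfl fun l _ => ?_
    rw [blockEnergy_pairSum, pow_succ', Nat.add_sub_add_right]
  · simp [blockEnergy]

/-- Induction on the scale: one pairing step leaves a sum of products at the finest level, paid for
by AM-GM with the energy of that level, and the coarser levels belong to the pair sums. -/
lemma norm_triSum_le (p : ℕ) (a b : ℕ → ℂ) :
    ‖triSum (2 ^ p) a b‖ ≤ (dyadicEnergy p a + dyadicEnergy p b) / 2 := by
  have hamgm : ∀ x y : ℝ, x * y ≤ (x ^ 2 + y ^ 2) / 2 := fun x y => by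
    nlinarith [sq_nonneg (x - y)]
  induction p generalizing a b with
  | zero =>
    simpa [triSum, dyadicEnergy, blockEnergy] using hamgm ‖a 0‖ ‖b 0‖
  | succ p ih =>
    have h1 : ∀ f : ℕ → ℂ, ∑ j ∈ Finset.range (2 ^ (p + 1)), ‖f j‖ ^ 2 =
        ∑ j ∈ Finset.range (2 ^ p), (‖f (2 * j)‖ ^ 2 + ‖f (2 * j + 1)‖ ^ 2) := by
      intro f
      rw [pow_succ']
      clear ih
      generalize 2 ^ p = M
      induction M with
      | zero => simp
      | succ M ih =>
        rw [Finset.sum_range_succ _ M, ← ih, mul_add_one, Finset.sum_range_succ,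
          Finset.sum_range_succ, add_assoc]
    have h2 : ‖∑ j ∈ Finset.range (2 ^ p), a (2 * j) * b (2 * j + 1)‖ ≤
        (∑ j ∈ Finset.range (2 ^ (p + 1)), ‖a j‖ ^ 2 +
          ∑ j ∈ Finset.range (2 ^ (p + 1)), ‖b j‖ ^ 2) / 2 := by
      rw [h1, h1, ← Finset.sum_add_distrib, Finset.sum_div]
      refine (norm_sum_le _ _).trans (Finset.sum_le_sum fun j _ => ?_)
      rw [norm_mul]
      have := hamgm ‖a (2 * j)‖ ‖b (2 * j + 1)‖
      nlinarith [sq_nonneg ‖a (2 * j + 1)‖, sq_nonneg ‖b (2 * j)‖]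
    rw [dyadicEnergy_succ, dyadicEnergy_succ, pow_succ', triSum_two_mul]
    have := (norm_sub_le (triSum (2 ^ p) (pairSum a) (pairSum b))
      (∑ j ∈ Finset.range (2 ^ p), a (2 * j) * b (2 * j + 1))).trans
      (add_le_add (ih (pairSum a) (pairSum b)) h2)
    rw [pow_succ'] at this
    linarith

lemma triSum_of_eq_zero {N M : ℕ} (hNM : N ≤ M) {a : ℕ → ℂ} (b : ℕ → ℂ)
    (ha : ∀ t, N ≤ t → a t = 0) : triSum M a b = triSum N a b := by
  refine (Finset.sum_subset (Finset.range_mono hNM) fun t _ ht => ?_).symm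
  simp only [Finset.mem_range, not_lt] at ht
  simp [ha t ht]

lemma dyadicEnergy_nonneg (p : ℕ) (a : ℕ → ℂ) : 0 ≤ dyadicEnergy p a :=
  Finset.sum_nonneg fun _ _ => Finset.sum_nonneg fun _ _ => by positivity

lemma sum_norm_sq_le_dyadicEnergy {N p : ℕ} (h : N ≤ 2 ^ p) (a : ℕ → ℂ) :
    ∑ t ∈ Finset.range N, ‖a t‖ ^ 2 ≤ dyadicEnergy p a := by
  calc ∑ t ∈ Finset.range N, ‖a t‖ ^ 2 ≤ ∑ t ∈ Finset.range (2 ^ p), ‖a t‖ ^ 2 :=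
        Finset.sum_le_sum_of_subset_of_nonneg (Finset.range_mono h) fun _ _ _ => by positivity
    _ = blockEnergy (2 ^ 0) (2 ^ (p - 0)) a := by simp [blockEnergy]
    _ ≤ dyadicEnergy p a :=
        Finset.single_le_sum (f := fun l => blockEnergy (2 ^ l) (2 ^ (p - l)) a)
          (fun l _ => Finset.sum_nonneg fun _ _ => by positivity) (by simp)

/-- Negative lags are written as `u - N` with `t < u < N`, which presents a full Toeplitz row as one
lower and one strictly upper triangular row. -/
lemma sum_range_toeplitz {N : ℕ} {t : ℕ} (ht : t < N) (b : ℤ → ℂ) :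
    ∑ τ ∈ Finset.range N, b (t - τ) =
      ∑ u ∈ Finset.range (t + 1), b u + ∑ u ∈ Finset.Ico (t + 1) N, b (u - N) := by
  rw [← Finset.sum_range_add_sum_Ico _ (Nat.succ_le_of_lt ht)]
  congr 1
  · rw [← Finset.sum_range_reflect]
    refine Finset.sum_congr rfl fun u hu => ?_
    simp only [Finset.mem_range] at hu
    congr 1
    omega
  · refine Finset.sum_bij (fun τ _ => t + N - τ) ?_ ?_ ?_ ?_
    · intro τ hτ
      simp at hτ ⊢
      omega
    · intro τ hτ τ' hτ' h
      simp at hτ hτ' h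
      omega
    · intro u hu
      simp at hu
      exact ⟨t + N - u, by simp; omega, by omega⟩
    · intro τ hτ
      simp at hτ
      congr 1
      omega

/-- A Toeplitz bilinear form is controlled by dyadic block sums. -/
lemma norm_toeplitz_sum_le {N p : ℕ} (hp : N ≤ 2 ^ p) (a b₁ b₂ : ℕ → ℂ) (b : ℤ → ℂ)
    (ha : ∀ t, N ≤ t → a t = 0) (hb₂0 : ∀ t, N ≤ t → b₂ t = 0)
    (hb₁ : ∀ t < N, b₁ t = b t) (hb₂ : ∀ t < N, b₂ t = b (t - N)) :
    ‖∑ t ∈ Finset.range N, a t * ∑ τ ∈ Finset.range N, b (t - τ)‖ ≤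
      2 * (dyadicEnergy p a + dyadicEnergy p b₁ + dyadicEnergy p b₂) := by
  -- The transposed triangle `triSum N b₂ a` includes the diagonal `u = t`, while the upper part of
  -- the Toeplitz row starts at `t + 1`; hence the subtraction.
  have e : ∑ t ∈ Finset.range N, a t * ∑ τ ∈ Finset.range N, b (t - τ) =
      triSum N a b₁ + triSum N b₂ a - ∑ t ∈ Finset.range N, a t * b₂ t := by
    have h1 : triSum N b₂ a = ∑ t ∈ Finset.range N, ∑ u ∈ Finset.Ico t N, a t * b₂ u := by
      rw [triSum, Finset.sum_comm' (t' := Finset.range N) (s' := fun t => Finset.Ico t N)]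
      · exact Finset.sum_congr rfl fun _ _ => Finset.sum_congr rfl fun _ _ => mul_comm _ _
      · intro x y
        simp
        omega
    rw [h1, triSum, ← Finset.sum_add_distrib, ← Finset.sum_sub_distrib]
    refine Finset.sum_congr rfl fun t ht => ?_
    simp only [Finset.mem_range] at ht
    rw [sum_range_toeplitz ht, ← Finset.mul_sum, ← Finset.mul_sum,
      Finset.sum_eq_sum_Ico_succ_bot ht b₂, mul_add, mul_add, add_sub_assoc, add_sub_cancel_left]
    congr 2
    · refine Finset.sum_congr rfl fun u hu => (hb₁ u ?_).symm
      simp only [Finset.mem_range] at hu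
      omega
    · refine Finset.sum_congr rfl fun u hu => (hb₂ u ?_).symm
      simp only [Finset.mem_Ico] at hu
      omega
  rw [e, ← triSum_of_eq_zero hp b₁ ha, ← triSum_of_eq_zero hp a hb₂0]
  have h3 : ‖∑ t ∈ Finset.range N, a t * b₂ t‖ ≤ (dyadicEnergy p a + dyadicEnergy p b₂) / 2 := by
    refine (norm_sum_le _ _).trans ?_
    have h4 := sum_norm_sq_le_dyadicEnergy hp a
    have h5 := sum_norm_sq_le_dyadicEnergy hp b₂
    have : ∑ t ∈ Finset.range N, ‖a t * b₂ t‖ ≤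
        ∑ t ∈ Finset.range N, (‖a t‖ ^ 2 + ‖b₂ t‖ ^ 2) / 2 := by
      refine Finset.sum_le_sum fun t _ => ?_
      rw [norm_mul]
      nlinarith [sq_nonneg (‖a t‖ - ‖b₂ t‖)]
    rw [← Finset.sum_div, Finset.sum_add_distrib] at this
    linarith
  have h1 := norm_triSum_le p a b₁
  have h2 := norm_triSum_le p b₂ a
  have h4 := norm_sub_le (triSum (2 ^ p) a b₁ + triSum (2 ^ p) b₂ a)
    (∑ t ∈ Finset.range N, a t * b₂ t)
  have h5 := norm_add_le (triSum (2 ^ p) a b₁) (triSum (2 ^ p) b₂ a)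
  have := dyadicEnergy_nonneg p a
  have := dyadicEnergy_nonneg p b₁
  have := dyadicEnergy_nonneg p b₂
  linarith

lemma dyadicEnergy_conj (p : ℕ) (a : ℕ → ℂ) :
    dyadicEnergy p (fun t => (starRingEnd ℂ) (a t)) = dyadicEnergy p a := by
  simp only [dyadicEnergy, blockEnergy, ← map_sum, RCLike.norm_conj]

end Dyadic

/-! ### Tails of the dyadic energies of a Gaussian vector -/

section DyadicTail

variable {ι : Type*} [Fintype ι]

lemma norm_sum_sq_of_orthogonal {E κ : Type*} [NormedAddCommGroup E] [InnerProductSpace ℂ E]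
    (s : Finset κ) (x : κ → E) (hx : ∀ i j, i ≠ j → inner ℂ (x i) (x j) = 0) :
    ‖∑ i ∈ s, x i‖ ^ 2 = ∑ i ∈ s, ‖x i‖ ^ 2 := by
  have h : ∀ y : E, ((‖y‖ ^ 2 : ℝ) : ℂ) = inner ℂ y y := fun y => by
    rw [inner_self_eq_norm_sq_to_K]
    simp
  have : ((‖∑ i ∈ s, x i‖ ^ 2 : ℝ) : ℂ) = ((∑ i ∈ s, ‖x i‖ ^ 2 : ℝ) : ℂ) := by
    rw [h, Complex.ofReal_sum, sum_inner]
    refine Finset.sum_congr rfl fun i hi => ?_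
    rw [inner_sum, h]
    exact Finset.sum_eq_single i (fun j _ hj => hx i j hj.symm) (fun h => absurd hi h)
  exact_mod_cast this

lemma form_sum {κ : Type*} (s : Finset κ) (v : κ → EuclideanSpace ℂ ι) (z : ι → ℂ) :
    form (∑ i ∈ s, v i) z = ∑ i ∈ s, form (v i) z := by
  simp [form]

/-- Sums of orthogonal vectors over disjoint blocks stay orthogonal, with squared norm at most `L`,
and a contraction preserves the resulting bound on linear combinations. Allowing `T` covers both the
raw and the projected noise. -/
lemma measure_blockEnergy_gt (T : EuclideanSpace ℂ ι →ₗ[ℂ] EuclideanSpace ℂ ι)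
    (hT : ∀ v, ‖T v‖ ≤ ‖v‖) (o : ℕ → EuclideanSpace ℂ ι)
    (ho : ∀ s t, s ≠ t → inner ℂ (o s) (o t) = 0) (ho1 : ∀ t, ‖o t‖ ≤ 1)
    {L : ℕ} (hL : 0 < L) (k : ℕ) {δ : ℝ} (hδ : 0 < δ) :
    gaussianVec ι {z | 4 * (L : ℝ) * (k * Real.log 2 + Real.log (1 / δ)) <
      blockEnergy L k fun t => form (T (o t)) z} ≤ ENNReal.ofReal δ := by
  set w : ℕ → EuclideanSpace ℂ ι := fun j => ∑ i ∈ Finset.range L, o (j * L + i) with hw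
  have hw1 : ∀ j, ‖w j‖ ^ 2 ≤ L := by
    intro j
    rw [hw, norm_sum_sq_of_orthogonal _ _ fun a b hab => ho _ _ (by omega)]
    calc _ ≤ ∑ i ∈ Finset.range L, (1 : ℝ) :=
          Finset.sum_le_sum fun i _ => pow_le_one₀ (norm_nonneg _) (ho1 _)
      _ = L := by simp
  have hw2 : ∀ j j', j ≠ j' → inner ℂ (w j) (w j') = 0 := by
    intro j j' hj
    simp only [hw, sum_inner, inner_sum]
    refine Finset.sum_eq_zero fun a ha => Finset.sum_eq_zero fun b hb => ho _ _ fun h => hj ?_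
    simp only [Finset.mem_range] at ha hb
    have h1 := congrArg (· / L) h
    simpa [Nat.add_div_of_dvd_right, Nat.mul_div_cancel _ hL, Nat.div_eq_of_lt ha,
      Nat.div_eq_of_lt hb] using h1
  have := measure_sum_form_sq_gt (κ := Fin k) (fun j => T (w j)) (c := L) (by exact_mod_cast hL) (by
    intro g
    have : ∑ j, g j • T (w j) = T (∑ j, g j • w j) := by simp
    rw [this]
    calc ‖T (∑ j, g j • w j)‖ ^ 2 ≤ ‖∑ j, g j • w j‖ ^ 2 := by
          gcongr
          exact hT _
      _ = ∑ j, ‖g j • w j‖ ^ 2 := by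
          refine norm_sum_sq_of_orthogonal _ _ fun a b hab => ?_
          rw [inner_smul_left, inner_smul_right, hw2 _ _ (fun h => hab (Fin.ext h))]
          simp
      _ ≤ ∑ j, L * ‖g j‖ ^ 2 := by
          refine Finset.sum_le_sum fun j _ => ?_
          rw [norm_smul, mul_pow, mul_comm]
          gcongr
          exact hw1 _
      _ = _ := by rw [Finset.mul_sum]) hδ
  rw [Fintype.card_fin] at this
  convert this using 5 with z
  rw [blockEnergy, Finset.sum_range]
  refine Finset.sum_congr rfl fun j _ => ?_
  rw [hw, map_sum, form_sum]

lemma measure_dyadicEnergy_gt (T : EuclideanSpace ℂ ι →ₗ[ℂ] EuclideanSpace ℂ ι)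
    (hT : ∀ v, ‖T v‖ ≤ ‖v‖) (o : ℕ → EuclideanSpace ℂ ι)
    (ho : ∀ s t, s ≠ t → inner ℂ (o s) (o t) = 0) (ho1 : ∀ t, ‖o t‖ ≤ 1)
    (p : ℕ) {δ : ℝ} (hδ : 0 < δ) (hδ1 : δ ≤ 1) :
    gaussianVec ι {z | 4 * 2 ^ p * ((p + 1) * Real.log 2 + 2 * Real.log (1 / δ)) <
      dyadicEnergy p fun t => form (T (o t)) z} ≤ (p + 1) * ENNReal.ofReal δ := by
  have hlog : 0 ≤ Real.log (1 / δ) := Real.log_nonneg (by rw [le_div_iff₀ hδ]; linarith)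
  calc _ ≤ gaussianVec ι (⋃ l ∈ Finset.range (p + 1),
        {z | 4 * ((2 ^ l : ℕ) : ℝ) * (((2 ^ (p - l) : ℕ) : ℝ) * Real.log 2 + Real.log (1 / δ)) <
          blockEnergy (2 ^ l) (2 ^ (p - l)) fun t => form (T (o t)) z}) := by
        refine measure_mono fun z hz => ?_
        by_contra hc
        simp only [Set.mem_iUnion, Set.mem_ofPred_eq, not_exists, not_lt] at hc hz
        refine absurd hz (not_lt.2 ?_)
        -- At level `l`, block length times block count is `2 ^ p`, so the mean term is the same at
        -- all `p + 1` levels, whereas the deviation terms form a geometric series dominated by `2 *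
        -- 2 ^ p`.
        calc dyadicEnergy p _ ≤ ∑ l ∈ Finset.range (p + 1), 4 * ((2 ^ l : ℕ) : ℝ) *
              (((2 ^ (p - l) : ℕ) : ℝ) * Real.log 2 + Real.log (1 / δ)) :=
              Finset.sum_le_sum hc
          _ = ∑ l ∈ Finset.range (p + 1), (4 * 2 ^ p * Real.log 2 +
              4 * Real.log (1 / δ) * 2 ^ l) := by
              refine Finset.sum_congr rfl fun l hl => ?_
              have : (2 : ℝ) ^ p = 2 ^ l * 2 ^ (p - l) := by
                rw [← pow_add]
                congr 1
                simp only [Finset.mem_range] at hl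
                omega
              rw [this]
              push_cast
              ring
          _ = (p + 1) * (4 * 2 ^ p * Real.log 2) + 4 * Real.log (1 / δ) * (2 ^ (p + 1) - 1) := by
              rw [Finset.sum_add_distrib, ← Finset.mul_sum _ _ (4 * Real.log (1 / δ)), geom_sum_eq (by norm_num)]
              simp
              norm_num
          _ ≤ _ := by
              rw [pow_succ]
              nlinarith
    _ ≤ ∑ l ∈ Finset.range (p + 1), gaussianVec ι
        {z | 4 * ((2 ^ l : ℕ) : ℝ) * (((2 ^ (p - l) : ℕ) : ℝ) * Real.log 2 + Real.log (1 / δ)) <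
          blockEnergy (2 ^ l) (2 ^ (p - l)) fun t => form (T (o t)) z} :=
        measure_biUnion_finset_le _ _
    _ ≤ ∑ l ∈ Finset.range (p + 1), ENNReal.ofReal δ :=
        Finset.sum_le_sum fun l _ => measure_blockEnergy_gt T hT o ho ho1 (by positivity) _ hδ
    _ = _ := by simp

end DyadicTail

/-! ### Windows, filters and modulations as vectors of observations -/

section Vectors

variable {n : ℕ}

/-- The coordinate vector of index `j`, zero when `j` is out of range. -/
noncomputable def unitVec (n : ℕ) (j : ℤ) : EuclideanSpace ℂ (ObsIdx n) :=
  if h : j ∈ Set.Icc (-(n : ℤ)) n then EuclideanSpace.single ⟨j, h⟩ 1 else 0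

lemma inner_unitVec_of_ne {i j : ℤ} (h : i ≠ j) : inner ℂ (unitVec n i) (unitVec n j) = 0 := by
  rw [unitVec, unitVec]
  split_ifs with hi hj
  · rw [EuclideanSpace.inner_single_left]
    simp [h]
  all_goals simp

lemma norm_unitVec_le (j : ℤ) : ‖unitVec n j‖ ≤ 1 := by
  rw [unitVec]
  split_ifs <;> simp

lemma norm_unitVec {j : ℤ} (h : j ∈ Set.Icc (-(n : ℤ)) n) : ‖unitVec n j‖ = 1 := by
  rw [unitVec, dif_pos h]
  simp

/-- The two-sided sequence with the observed entries `z`, extended by zero. -/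
noncomputable def extend (z : ObsIdx n → ℂ) : Signal := fun j => form (unitVec n j) z

lemma extend_apply (z : ObsIdx n → ℂ) (i : ObsIdx n) : extend z i = z i := by
  rw [extend, unitVec, dif_pos i.2, form, EuclideanSpace.inner_single_left]
  simp

/-- The part of a signal on `[0, n]` as a vector. -/
noncomputable def window (n : ℕ) : Signal →ₗ[ℂ] EuclideanSpace ℂ (ObsIdx n) where
  toFun f := ∑ t ∈ Finset.range (n + 1), f (t : ℤ) • unitVec n t
  map_add' f g := by simp [add_smul, Finset.sum_add_distrib]
  map_smul' c f := by simp [Finset.smul_sum, mul_smul]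

lemma window_apply (f : Signal) :
    window n f = ∑ t ∈ Finset.range (n + 1), f (t : ℤ) • unitVec n t := rfl

lemma mem_obs_of_mem_range {t : ℕ} (ht : t ∈ Finset.range (n + 1)) :
    (t : ℤ) ∈ Set.Icc (-(n : ℤ)) n := by
  simp at ht ⊢
  omega

lemma norm_window (f : Signal) : ‖window n f‖ = l2Norm n f := by
  rw [l2Norm, eq_comm, Real.sqrt_eq_iff_mul_self_eq (by positivity) (by positivity), ← sq,
    window_apply, norm_sum_sq_of_orthogonal]
  · refine Finset.sum_congr rfl fun t ht => ?_
    rw [norm_smul, norm_unitVec (mem_obs_of_mem_range ht), mul_one]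
  · intro i j hij
    rw [inner_smul_left, inner_smul_right, inner_unitVec_of_ne (by exact_mod_cast hij)]
    simp

lemma window_congr {f g : Signal} (h : ∀ t ∈ Finset.range (n + 1), f (t : ℤ) = g (t : ℤ)) :
    window n f = window n g := by
  rw [window_apply, window_apply]
  exact Finset.sum_congr rfl fun t ht => by rw [h t ht]

lemma inner_window (q : EuclideanSpace ℂ (ObsIdx n)) (f : Signal) :
    inner ℂ q (window n f) =
      ∑ t ∈ Finset.range (n + 1), f t * (starRingEnd ℂ) (inner ℂ (unitVec n t) q) := by
  simp only [window_apply, inner_sum, inner_smul_right, inner_conj_symm]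

/-- Noise at negative times is orthogonal to every window. The residual sees only `[0, n]`, yet the
projection may be taken of the full noise vector. -/
lemma inner_window_extend (z : ObsIdx n → ℂ) (f : Signal) :
    inner ℂ (window n (extend z)) (window n f) = inner ℂ (WithLp.toLp 2 z) (window n f) := by
  rw [inner_window, inner_window]
  refine Finset.sum_congr rfl fun t ht => ?_
  have h1 : inner ℂ (unitVec n t) (window n (extend z)) = extend z t := by
    rw [inner_window, Finset.sum_eq_single t]
    · rw [inner_self_eq_norm_sq_to_K, norm_unitVec (mem_obs_of_mem_range ht)]
      simp
    · intro u _ hu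
      rw [inner_unitVec_of_ne (by exact_mod_cast hu)]
      simp
    · exact fun h => absurd ht h
  rw [h1]
  rfl

/-- The coefficients of `[φ * ζ]_t` as a linear form of the noise. -/
noncomputable def convVec (n k : ℕ) (φ : Signal) (t : ℤ) : EuclideanSpace ℂ (ObsIdx n) :=
  ∑ j ∈ Finset.range (k + 1), (starRingEnd ℂ) (φ j) • unitVec n (t - j)

lemma form_convVec {k : ℕ} {φ : Signal} (hφ : SupportedOn k φ) (t : ℤ) (z : ObsIdx n → ℂ) :
    form (convVec n k φ t) z = conv φ (extend z) t := by
  rw [conv_eq_sum hφ, convVec, form_sum]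
  refine Finset.sum_congr rfl fun j _ => ?_
  simp [form, extend, mul_comm]

lemma norm_convVec_sq_le (k : ℕ) (φ : Signal) (t : ℤ) : ‖convVec n k φ t‖ ^ 2 ≤ l2Norm k φ ^ 2 := by
  rw [l2Norm, Real.sq_sqrt (by positivity), convVec, norm_sum_sq_of_orthogonal]
  · refine Finset.sum_le_sum fun j _ => ?_
    rw [norm_smul, RCLike.norm_conj, mul_pow]
    exact mul_le_of_le_one_right (by positivity) (pow_le_one₀ (norm_nonneg _) (norm_unitVec_le _))
  · intro i j hij
    rw [inner_smul_left, inner_smul_right, inner_unitVec_of_ne (by simpa using hij)]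
    simp

/-- Modulated coordinate vectors, delayed by `d`. -/
noncomputable def modVec (n k d : ℕ) (t : ℕ) : EuclideanSpace ℂ (ObsIdx n) :=
  if t < n + 1 then (starRingEnd ℂ) ((dftRoot n ^ k) ^ ((t : ℤ) - d)) • unitVec n ((t : ℤ) - d)
  else 0

lemma inner_modVec_of_ne (k d : ℕ) (s t : ℕ) (h : s ≠ t) :
    inner ℂ (modVec n k d s) (modVec n k d t) = 0 := by
  rw [modVec, modVec]
  split_ifs
  · rw [inner_smul_left, inner_smul_right, inner_unitVec_of_ne (by omega)]
    simp
  all_goals simp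

lemma norm_modVec_le (k d t : ℕ) : ‖modVec n k d t‖ ≤ 1 := by
  rw [modVec]
  split_ifs
  · rw [norm_smul, RCLike.norm_conj, norm_zpow, norm_pow, norm_dftRoot]
    simpa using norm_unitVec_le _
  · simp

lemma inner_modVec (k d t : ℕ) (q : EuclideanSpace ℂ (ObsIdx n)) :
    inner ℂ (modVec n k d t) q =
      if t < n + 1 then (dftRoot n ^ k) ^ ((t : ℤ) - d) * inner ℂ (unitVec n ((t : ℤ) - d)) q
      else 0 := by
  rw [modVec]
  split_ifs
  · rw [inner_smul_left, Complex.conj_conj]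
  · simp

end Vectors

/-! ### Deterministic inequalities for the residual -/

section Deterministic

variable {n : ℕ}

lemma shift_pow_apply (τ : ℕ) (f : Signal) (t : ℤ) : (shift ^ τ) f t = f (t - τ) := by
  induction τ generalizing t with
  | zero => simp
  | succ τ ih =>
    rw [pow_succ', Module.End.mul_apply]
    change (shift ^ τ) f (t - 1) = _
    rw [ih]
    congr 1
    push_cast
    ring

lemma conv_eq_sum_shift {k : ℕ} {φ : Signal} (hφ : SupportedOn k φ) (v : Signal) :
    conv φ v = ∑ j ∈ Finset.range (k + 1), φ j • (shift ^ j) v := by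
  ext t
  rw [conv_eq_sum hφ, Finset.sum_apply]
  exact Finset.sum_congr rfl fun j _ => by rw [Pi.smul_apply, shift_pow_apply, smul_eq_mul]

lemma conv_mem {S : Submodule ℂ Signal} (hS : S.map shift = S) {k : ℕ} {φ : Signal}
    (hφ : SupportedOn k φ) {v : Signal} (hv : v ∈ S) : conv φ v ∈ S := by
  rw [conv_eq_sum_shift hφ]
  refine S.sum_mem fun j hj => S.smul_mem _ ?_
  clear hφ hj
  induction j with
  | zero => simpa using hv
  | succ j ih =>
    rw [pow_succ', Module.End.mul_apply]
    exact hS ▸ Submodule.mem_map_of_mem ih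

/-- Bound for `⟨q, φ * ζ⟩` over filters `φ` with small spectral norm. -/
lemma norm_inner_window_conv_extend_le {ψ : Signal} (hψ : SupportedOn n ψ) (z : ObsIdx n → ℂ)
    (q : EuclideanSpace ℂ (ObsIdx n)) {p : ℕ} (hp : n + 1 ≤ 2 ^ p) {B : ℝ}
    (hq : ∀ k ∈ Finset.range (n + 1), dyadicEnergy p (fun t => inner ℂ (modVec n k 0 t) q) ≤ B)
    (hz : ∀ k ∈ Finset.range (n + 1), dyadicEnergy p (fun t => form (modVec n k 0 t) z) ≤ B)
    (hz' : ∀ k ∈ Finset.range (n + 1),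
      dyadicEnergy p (fun t => form (modVec n k (n + 1) t) z) ≤ B) :
    ‖inner ℂ q (window n (conv ψ (extend z)))‖ ≤
      6 * B * specL1 n ψ / √((n : ℝ) + 1) := by
  have hroot : ∀ k : ℕ, dftRoot n ^ k ≠ 0 := fun k => pow_ne_zero _ (dftRoot_ne_zero n)
  set a : ℕ → ℕ → ℂ := fun k t => (starRingEnd ℂ) (inner ℂ (modVec n k 0 t) q) with ha
  set b : ℕ → ℤ → ℂ := fun k j => (dftRoot n ^ k) ^ j * extend z j with hb
  -- Fourier inversion of `ψ` together with `w^(-τ) = w^(-t) * w^(t-τ)` distributes the modulation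
  -- between `q` and the noise. Each frequency leaves a Toeplitz form of the kind bounded above.
  have e1 : ∀ t ∈ Finset.range (n + 1), conv ψ (extend z) t *
      (starRingEnd ℂ) (inner ℂ (unitVec n t) q) = ((√((n : ℝ) + 1))⁻¹ : ℝ) *
      ∑ k ∈ Finset.range (n + 1), dft n ψ k *
        (a k t * ∑ τ ∈ Finset.range (n + 1), b k (t - τ)) := by
    intro t ht
    have hat : ∀ k, a k t = (starRingEnd ℂ) (inner ℂ (unitVec n t) q) *
        (dftRoot n ^ k) ^ (-(t : ℤ)) := by
      intro k
      simp only [ha, inner_modVec, if_pos (Finset.mem_range.1 ht), map_mul, Nat.cast_zero, sub_zero]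
      rw [mul_comm, zpow_neg, Complex.inv_eq_conj (by simp [norm_dftRoot])]
    rw [conv_eq_sum hψ, Finset.sum_mul]
    have h1 : ∀ τ ∈ Finset.range (n + 1), ψ τ * extend z (t - τ) *
        (starRingEnd ℂ) (inner ℂ (unitVec n t) q) = ∑ k ∈ Finset.range (n + 1),
          ((√((n : ℝ) + 1))⁻¹ : ℝ) * (dft n ψ k * (a k t * b k (t - τ))) := by
      intro τ hτ
      rw [dft_inversion ψ hτ, Finset.mul_sum, Finset.sum_mul, Finset.sum_mul]
      refine Finset.sum_congr rfl fun k _ => ?_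
      simp only [hat, hb]
      have : (dftRoot n ^ k) ^ (-(τ : ℤ)) =
          (dftRoot n ^ k) ^ (-(t : ℤ)) * (dftRoot n ^ k) ^ ((t : ℤ) - τ) := by
        rw [← zpow_add₀ (hroot k)]
        congr 1
        ring
      rw [this]
      ring
    rw [Finset.sum_congr rfl h1, Finset.sum_comm, Finset.mul_sum]
    refine Finset.sum_congr rfl fun k _ => ?_
    simp_rw [Finset.mul_sum]
  have e2 : inner ℂ q (window n (conv ψ (extend z))) = ((√((n : ℝ) + 1))⁻¹ : ℝ) *
      ∑ k ∈ Finset.range (n + 1), dft n ψ k *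
        ∑ t ∈ Finset.range (n + 1), a k t * ∑ τ ∈ Finset.range (n + 1), b k (t - τ) := by
    rw [inner_window, Finset.sum_congr rfl e1, ← Finset.mul_sum, Finset.sum_comm]
    simp_rw [Finset.mul_sum]
  have e3 : ∀ k ∈ Finset.range (n + 1),
      ‖∑ t ∈ Finset.range (n + 1), a k t * ∑ τ ∈ Finset.range (n + 1), b k (t - τ)‖ ≤ 6 * B := by
    intro k hk
    have := norm_toeplitz_sum_le hp (a k) (fun t => form (modVec n k 0 t) z)
      (fun t => form (modVec n k (n + 1) t) z) (b k)
      (fun t ht => by simp only [ha, inner_modVec, if_neg (not_lt.2 ht), map_zero])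
      (fun t ht => by simp only [form, inner_modVec, if_neg (not_lt.2 ht)])
      (fun t ht => by simp [form, inner_modVec, ht, hb, extend])
      (fun t ht => by simp only [form, inner_modVec, if_pos ht, hb, extend])
    rw [dyadicEnergy_conj] at this
    linarith [hq k hk, hz k hk, hz' k hk]
  rw [e2, norm_mul, Complex.norm_real, Real.norm_of_nonneg (by positivity), mul_comm, div_eq_mul_inv]
  refine mul_le_mul_of_nonneg_right ?_ (by positivity)
  refine (norm_sum_le _ _).trans ?_
  rw [specL1, Finset.mul_sum]
  refine Finset.sum_le_sum fun k hk => ?_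
  rw [norm_mul, mul_comm]
  exact mul_le_mul_of_nonneg_right (e3 k hk) (norm_nonneg _)

/-- Cauchy–Schwarz over the delays separates the filter from the inner products with the shifted
errors, which do not involve the filter. The bound is thus uniform in `ψ`. -/
lemma norm_inner_window_conv_le {ψ : Signal} (hψ : SupportedOn n ψ) (ε : Signal)
    (q : EuclideanSpace ℂ (ObsIdx n)) {A : ℝ}
    (hA : ∑ τ ∈ Finset.range (n + 1), ‖inner ℂ q (window n ((shift ^ τ) ε))‖ ^ 2 ≤ A) :
    ‖inner ℂ q (window n (conv ψ ε))‖ ≤ specL1 n ψ * √A := by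
  rw [conv_eq_sum_shift hψ, map_sum, inner_sum]
  calc _ ≤ ∑ τ ∈ Finset.range (n + 1), ‖ψ τ‖ * ‖inner ℂ q (window n ((shift ^ τ) ε))‖ := by
        refine (norm_sum_le _ _).trans (le_of_eq (Finset.sum_congr rfl fun τ _ => ?_))
        rw [map_smul, inner_smul_right, norm_mul]
    _ ≤ l2Norm n ψ * √(∑ τ ∈ Finset.range (n + 1),
          ‖inner ℂ q (window n ((shift ^ τ) ε))‖ ^ 2) :=
        Real.sum_mul_le_sqrt_mul_sqrt _ _ _
    _ ≤ _ := mul_le_mul (l2Norm_le_specL1 n ψ) (Real.sqrt_le_sqrt hA) (Real.sqrt_nonneg _)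
        ((Real.sqrt_nonneg _).trans (l2Norm_le_specL1 n ψ))

/-- Decomposition of `⟨ζ, x - ψ * y⟩` along a shift-invariant subspace. -/
lemma norm_inner_window_residual_le {S : Submodule ℂ Signal} (hS : S.map shift = S)
    {xS ε : Signal} (hxS : xS ∈ S) {σ : ℝ} (hσ : 0 ≤ σ) {ψ : Signal} (hψ : SupportedOn n ψ)
    (z : ObsIdx n → ℂ) :
    ‖inner ℂ (WithLp.toLp 2 z) (window n (xS + ε - conv ψ (xS + ε + (σ : ℂ) • extend z)))‖ ≤
      ‖(S.map (window n)).starProjection (WithLp.toLp 2 z)‖ *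
        l2Norm n (xS + ε - conv ψ (xS + ε + (σ : ℂ) • extend z)) +
      ‖inner ℂ ((S.map (window n))ᗮ.starProjection (WithLp.toLp 2 z)) (window n ε)‖ +
      ‖inner ℂ ((S.map (window n))ᗮ.starProjection (WithLp.toLp 2 z)) (window n (conv ψ ε))‖ +
      σ * ‖inner ℂ ((S.map (window n))ᗮ.starProjection (WithLp.toLp 2 z))
        (window n (conv ψ (extend z)))‖ := by
  set V := S.map (window n) with hV
  set f := xS + ε - conv ψ (xS + ε + (σ : ℂ) • extend z) with hf
  set q := Vᗮ.starProjection (WithLp.toLp 2 z) with hq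
  have h1 : inner ℂ (WithLp.toLp 2 z) (window n f) =
      inner ℂ (V.starProjection (WithLp.toLp 2 z)) (window n f) + inner ℂ q (window n f) := by
    rw [← inner_add_left, hq, Submodule.starProjection_add_starProjection_orthogonal]
  have h2 : f = (xS - conv ψ xS) + ε - conv ψ ε - (σ : ℂ) • conv ψ (extend z) := by
    rw [hf, conv_add_right hψ, conv_add_right hψ, conv_smul_right hψ]
    abel
  -- Shift invariance puts `xS - ψ * xS` in `S` whatever the filter, so `q`, orthogonal to the
  -- window of `S`, does not see it.
  have h3 : inner ℂ q (window n (xS - conv ψ xS)) = 0 := by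
    refine Submodule.inner_left_of_mem_orthogonal (K := V) ?_ (Submodule.starProjection_apply_mem _ _)
    exact Submodule.mem_map_of_mem (S.sub_mem hxS (conv_mem hS hψ hxS))
  have h4 : inner ℂ q (window n f) = inner ℂ q (window n ε) - inner ℂ q (window n (conv ψ ε)) -
      σ * inner ℂ q (window n (conv ψ (extend z))) := by
    rw [h2, map_sub, map_sub, map_add, map_smul, inner_sub_right, inner_sub_right, inner_add_right,
      h3, inner_smul_right, zero_add]
  rw [h1, h4, ← norm_window]
  have n1 := norm_inner_le_norm (𝕜 := ℂ) (V.starProjection (WithLp.toLp 2 z)) (window n f)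
  have n2 : ‖(σ : ℂ) * inner ℂ q (window n (conv ψ (extend z)))‖ =
      σ * ‖inner ℂ q (window n (conv ψ (extend z)))‖ := by
    rw [norm_mul, Complex.norm_real, Real.norm_of_nonneg hσ]
  have n3 := norm_add_le (inner ℂ (V.starProjection (WithLp.toLp 2 z)) (window n f))
    (inner ℂ q (window n ε) - inner ℂ q (window n (conv ψ ε)) -
      σ * inner ℂ q (window n (conv ψ (extend z))))
  have n4 := norm_sub_le (inner ℂ q (window n ε) - inner ℂ q (window n (conv ψ ε)))
    (σ * inner ℂ q (window n (conv ψ (extend z))))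
  have n5 := norm_sub_le (inner ℂ q (window n ε)) (inner ℂ q (window n (conv ψ ε)))
  linarith

/-- The basic inequality for a minimizer of the residual. -/
lemma norm_le_of_residual_le {E : Type*} [NormedAddCommGroup E] [InnerProductSpace ℂ E]
    {u u₀ g : E} {σ A R : ℝ} (hσ : 0 ≤ σ) (hA : 0 ≤ A) (hR : 0 ≤ R)
    (h : ‖u + (σ : ℂ) • g‖ ≤ ‖u₀ + (σ : ℂ) • g‖)
    (hu : ‖inner ℂ g u‖ ≤ A * ‖u‖ + R) (hu₀ : ‖inner ℂ g u₀‖ ≤ A * ‖u₀‖ + R) :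
    ‖u‖ ≤ ‖u₀‖ + 2 * σ * A + 2 * √(σ * R) := by
  have e : ∀ w : E, ‖w + (σ : ℂ) • g‖ ^ 2 =
      ‖w‖ ^ 2 + 2 * σ * (inner ℂ g w).re + ‖(σ : ℂ) • g‖ ^ 2 := by
    intro w
    have h0 := @norm_add_sq ℂ _ _ _ _ w ((σ : ℂ) • g)
    have h1 : (inner ℂ w g).re = (inner ℂ g w).re := by
      rw [← inner_conj_symm, Complex.conj_re]
    rw [inner_smul_right, RCLike.re_to_complex, Complex.re_ofReal_mul, h1] at h0
    linarith
  have h1 := pow_le_pow_left₀ (norm_nonneg _) h 2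
  rw [e, e] at h1
  have h2 := (Complex.abs_re_le_norm (inner ℂ g u)).trans hu
  have h3 := (Complex.abs_re_le_norm (inner ℂ g u₀)).trans hu₀
  have h4 : ‖u‖ ^ 2 ≤ ‖u₀‖ ^ 2 + 2 * σ * (A * ‖u‖ + A * ‖u₀‖ + 2 * R) := by
    have := (abs_le.1 h2).1
    have := (abs_le.1 h3).2
    nlinarith
  -- Completing squares in `h4` gives `(‖u‖ - σA)² ≤ (‖u₀‖ + σA)² + 4σR`; the last term is
  -- `(2√(σR))²`.
  have h5 : (‖u‖ - σ * A) ^ 2 ≤ (‖u₀‖ + σ * A + 2 * √(σ * R)) ^ 2 := by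
    have h6 : √(σ * R) ^ 2 = σ * R := Real.sq_sqrt (by positivity)
    have h7 : 0 ≤ (‖u₀‖ + σ * A) * √(σ * R) := by positivity
    nlinarith
  have := (abs_le_of_sq_le_sq' h5 (by positivity)).2
  linarith

end Deterministic

/-! ### The exceptional set of the noise -/

section Tails

variable {ι : Type*} [Fintype ι]

lemma measure_norm_starProjection_gt (V : Submodule ℂ (EuclideanSpace ℂ ι)) {s : ℕ}
    (hs : Module.finrank ℂ V ≤ s) {δ : ℝ} (hδ : 0 < δ) :
    gaussianVec ι {z | 4 * (s * Real.log 2 + Real.log (1 / δ)) <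
      ‖V.starProjection (WithLp.toLp 2 z)‖ ^ 2} ≤ ENNReal.ofReal δ := by
  have hb := stdOrthonormalBasis ℂ V
  have := measure_sum_form_sq_gt (fun j => (hb j : EuclideanSpace ℂ ι)) one_pos (by
    intro g
    rw [norm_sum_sq_of_orthogonal]
    · refine le_of_eq ?_
      rw [one_mul]
      refine Finset.sum_congr rfl fun j _ => ?_
      rw [norm_smul, Submodule.norm_coe, hb.norm_eq_one, mul_one]
    · intro i j hij
      rw [inner_smul_left, inner_smul_right, ← Submodule.coe_inner, hb.inner_eq_zero hij]
      simp) hδ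
  refine le_trans (measure_mono fun z hz => ?_) this
  rw [Set.mem_ofPred_eq] at hz ⊢
  have e : ∑ j, ‖form (hb j : EuclideanSpace ℂ ι) z‖ ^ 2 =
      ‖V.starProjection (WithLp.toLp 2 z)‖ ^ 2 := by
    rw [Submodule.starProjection_apply, Submodule.norm_coe, ← hb.sum_sq_norm_inner_right]
    simp only [form, Submodule.inner_orthogonalProjectionOnto_eq_of_mem_left]
  rw [e]
  refine lt_of_le_of_lt ?_ hz
  rw [Fintype.card_fin, mul_one]
  have : (Module.finrank ℂ V : ℝ) ≤ s := by exact_mod_cast hs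
  have := mul_le_mul_of_nonneg_right this (Real.log_nonneg one_le_two)
  linarith

variable {n : ℕ}

/-- The realizations of the noise for which the recovery is accurate. -/
structure IsRegularNoise (V : Submodule ℂ (EuclideanSpace ℂ (ObsIdx n))) (s p : ℕ)
    (φ ε : Signal) (c α B : ℝ) (z : ObsIdx n → ℂ) : Prop where
  proj : ‖V.starProjection (WithLp.toLp 2 z)‖ ^ 2 ≤
    4 * (s * Real.log 2 + Real.log (1 / (α / 5)))
  filtered : l2Norm n (conv φ (extend z)) ^ 2 ≤
    4 * l2Norm n φ ^ 2 * (n + 1) * (Real.log 2 + Real.log (1 / (α / 5)))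
  shifts : ∑ τ ∈ Finset.range (n + 1), ‖inner ℂ (Vᗮ.starProjection (WithLp.toLp 2 z))
      (window n ((shift ^ τ) ε))‖ ^ 2 ≤
    4 * c ^ 2 * (n + 1) * (Real.log 2 + Real.log (1 / (α / 5)))
  error : ‖inner ℂ (Vᗮ.starProjection (WithLp.toLp 2 z)) (window n ε)‖ ^ 2 ≤
    4 * c ^ 2 * (Real.log 2 + Real.log (1 / (α / 5)))
  blocks : ∀ k ∈ Finset.range (n + 1),
    dyadicEnergy p (fun t => inner ℂ (modVec n k 0 t) (Vᗮ.starProjection (WithLp.toLp 2 z))) ≤ B ∧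
    dyadicEnergy p (fun t => form (modVec n k 0 t) z) ≤ B ∧
    dyadicEnergy p (fun t => form (modVec n k (n + 1) t) z) ≤ B

lemma measure_not_isRegularNoise (V : Submodule ℂ (EuclideanSpace ℂ (ObsIdx n))) {s p : ℕ}
    (hs : Module.finrank ℂ V ≤ s) (hp : p + 1 ≤ 2 * (n + 1)) {φ ε : Signal}
    (hφ : SupportedOn n φ) {c α : ℝ} (hc : ∀ τ ≤ n, l2Norm n ((shift ^ τ) ε) ≤ c)
    (hα : 0 < α) (hα1 : α ≤ 1) :
    gaussianVec (ObsIdx n) {z | ¬ IsRegularNoise V s p φ ε c α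
      (4 * 2 ^ p * ((p + 1) * Real.log 2 + 2 * Real.log (1 / (α / (30 * ((n : ℝ) + 1) ^ 2))))) z} ≤
      ENNReal.ofReal α := by
  have hc0 : 0 ≤ c := (Real.sqrt_nonneg _).trans (hc 0 (Nat.zero_le _))
  have hα5 : 0 < α / 5 := by positivity
  have hα51 : α / 5 ≤ 1 := by linarith
  have hδ : 0 < α / (30 * ((n : ℝ) + 1) ^ 2) := by positivity
  have hδ1 : α / (30 * ((n : ℝ) + 1) ^ 2) ≤ 1 := by
    rw [div_le_one (by positivity)]
    nlinarith [Nat.cast_nonneg (α := ℝ) n]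
  -- Five events share `α` equally. The block event is a union over `n + 1` frequencies, three
  -- families and `p + 1 ≤ 2(n + 1)` levels, at most `6(n + 1)²` sets, whence `30`.
  set δ := α / (30 * ((n : ℝ) + 1) ^ 2) with hδdef
  set B := 4 * 2 ^ p * ((p + 1) * Real.log 2 + 2 * Real.log (1 / δ)) with hB
  set Q := Vᗮ.starProjection with hQ
  have hQn : ∀ v, ‖Q v‖ ≤ ‖v‖ := Vᗮ.norm_starProjection_apply_le
  -- Self-adjointness moves the projection from the noise onto the coefficient vector, so forms of
  -- projected noise are again forms of i.i.d. noise.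
  have hQf : ∀ v z, form (Q v) z = inner ℂ v (Q (WithLp.toLp 2 z)) := fun v z =>
    Submodule.inner_starProjection_left_eq_right _ _ _
  have hwin : ∀ τ ≤ n, ‖Q (window n ((shift ^ τ) ε))‖ ^ 2 ≤ c ^ 2 := fun τ hτ =>
    pow_le_pow_left₀ (norm_nonneg _) ((hQn _).trans ((norm_window _).trans_le (hc τ hτ))) 2
  have m1 := measure_norm_starProjection_gt V hs hα5
  have m2 : gaussianVec (ObsIdx n) {z | 4 * l2Norm n φ ^ 2 * (n + 1) *
      (Real.log 2 + Real.log (1 / (α / 5))) < l2Norm n (conv φ (extend z)) ^ 2} ≤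
      ENNReal.ofReal (α / 5) := by
    have := measure_sum_form_sq_gt_of_norm_le (fun t : Fin (n + 1) => convVec n n φ (t : ℕ))
      (sq_nonneg (l2Norm n φ)) (fun t => norm_convVec_sq_le n φ _) hα5 hα51
    simp only [form_convVec hφ, Fintype.card_fin, Nat.cast_add, Nat.cast_one] at this
    have e : ∀ z : ObsIdx n → ℂ, l2Norm n (conv φ (extend z)) ^ 2 =
        ∑ t : Fin (n + 1), ‖conv φ (extend z) (t : ℕ)‖ ^ 2 := fun z => by
      rw [l2Norm, Real.sq_sqrt (by positivity), Finset.sum_range]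
    simpa only [e] using this
  have m3 : gaussianVec (ObsIdx n) {z | 4 * c ^ 2 * (n + 1) *
      (Real.log 2 + Real.log (1 / (α / 5))) < ∑ τ ∈ Finset.range (n + 1),
        ‖inner ℂ (Q (WithLp.toLp 2 z)) (window n ((shift ^ τ) ε))‖ ^ 2} ≤
      ENNReal.ofReal (α / 5) := by
    have := measure_sum_form_sq_gt_of_norm_le
      (fun τ : Fin (n + 1) => Q (window n ((shift ^ (τ : ℕ)) ε)))
      (sq_nonneg c) (fun τ => hwin τ (Nat.lt_succ_iff.1 τ.2)) hα5 hα51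
    simp only [hQf, Fintype.card_fin, Nat.cast_add, Nat.cast_one] at this
    have e : ∀ z : ObsIdx n → ℂ, ∑ τ ∈ Finset.range (n + 1),
        ‖inner ℂ (Q (WithLp.toLp 2 z)) (window n ((shift ^ τ) ε))‖ ^ 2 = ∑ τ : Fin (n + 1),
        ‖inner ℂ (window n ((shift ^ (τ : ℕ)) ε)) (Q (WithLp.toLp 2 z))‖ ^ 2 := fun z => by
      rw [Finset.sum_range]
      exact Finset.sum_congr rfl fun τ _ => by rw [norm_inner_symm]
    simpa only [e] using this
  have m4 : gaussianVec (ObsIdx n) {z | 4 * c ^ 2 * (Real.log 2 + Real.log (1 / (α / 5))) <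
      ‖inner ℂ (Q (WithLp.toLp 2 z)) (window n ε)‖ ^ 2} ≤ ENNReal.ofReal (α / 5) := by
    have := measure_sum_form_sq_gt_of_norm_le (fun _ : Unit => Q (window n ε))
      (sq_nonneg c) (fun _ => by simpa using hwin 0 (Nat.zero_le _)) hα5 hα51
    simp only [hQf, Fintype.card_unit, Nat.cast_one, mul_one, Finset.univ_unique,
      Finset.sum_singleton] at this
    convert this using 5
    rw [norm_inner_symm]
  have m5 : gaussianVec (ObsIdx n) (⋃ k ∈ Finset.range (n + 1),
      ({z | B < dyadicEnergy p fun t => inner ℂ (modVec n k 0 t) (Q (WithLp.toLp 2 z))} ∪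
        {z | B < dyadicEnergy p fun t => form (modVec n k 0 t) z} ∪
        {z | B < dyadicEnergy p fun t => form (modVec n k (n + 1) t) z})) ≤
      ENNReal.ofReal (α / 5) := by
    calc _ ≤ ∑ k ∈ Finset.range (n + 1), ((p + 1) * ENNReal.ofReal δ + (p + 1) * ENNReal.ofReal δ +
          (p + 1) * ENNReal.ofReal δ) := by
          refine (measure_biUnion_finset_le _ _).trans (Finset.sum_le_sum fun k _ => ?_)
          refine (measure_union_le _ _).trans (add_le_add ((measure_union_le _ _).trans
            (add_le_add ?_ ?_)) ?_)
          · have := measure_dyadicEnergy_gt Q.toLinearMap hQn (modVec n k 0)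
              (inner_modVec_of_ne k 0) (norm_modVec_le k 0) p hδ hδ1
            simpa only [ContinuousLinearMap.coe_coe, hQf] using this
          · exact measure_dyadicEnergy_gt LinearMap.id (fun _ => le_rfl) (modVec n k 0)
              (inner_modVec_of_ne k 0) (norm_modVec_le k 0) p hδ hδ1
          · exact measure_dyadicEnergy_gt LinearMap.id (fun _ => le_rfl) (modVec n k (n + 1))
              (inner_modVec_of_ne k (n + 1)) (norm_modVec_le k (n + 1)) p hδ hδ1
      _ = ENNReal.ofReal (((n : ℝ) + 1) * (3 * (((p : ℝ) + 1) * δ))) := by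
          have e : ((p : ENNReal) + 1) * ENNReal.ofReal δ = ENNReal.ofReal (((p : ℝ) + 1) * δ) := by
            rw [ENNReal.ofReal_mul (by positivity)]
            congr 1
            exact_mod_cast (ENNReal.ofReal_natCast (p + 1)).symm
          rw [e, ← ENNReal.ofReal_add (by positivity) (by positivity),
            ← ENNReal.ofReal_add (by positivity) (by positivity), Finset.sum_const,
            Finset.card_range, nsmul_eq_mul, ← ENNReal.ofReal_natCast,
            ← ENNReal.ofReal_mul (by positivity)]
          congr 1
          push_cast
          ring
      _ ≤ ENNReal.ofReal (α / 5) := by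
          refine ENNReal.ofReal_le_ofReal ?_
          have h1 : (p : ℝ) + 1 ≤ 2 * ((n : ℝ) + 1) := by exact_mod_cast hp
          calc ((n : ℝ) + 1) * (3 * (((p : ℝ) + 1) * δ))
              ≤ ((n : ℝ) + 1) * (3 * ((2 * ((n : ℝ) + 1)) * δ)) := by gcongr
            _ = α / 5 := by
              rw [hδdef]
              field_simp
              norm_num
  refine le_trans (measure_mono (t := (((_ ∪ _) ∪ _) ∪ _) ∪ _) fun z hz => ?_)
    ((measure_union_le _ _).trans (add_le_add ((measure_union_le _ _).trans (add_le_add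
      ((measure_union_le _ _).trans (add_le_add ((measure_union_le _ _).trans (add_le_add m1 m2))
        m3)) m4)) m5) |>.trans ?_)
  · by_contra hcon
    simp only [Set.mem_union, Set.mem_iUnion, Set.mem_ofPred_eq, not_or, not_exists, not_lt]
      at hcon
    exact hz ⟨hcon.1.1.1.1, hcon.1.1.1.2, hcon.1.1.2, hcon.1.2,
      fun k hk => ⟨(hcon.2 k hk).1.1, (hcon.2 k hk).1.2, (hcon.2 k hk).2⟩⟩
  · rw [← ENNReal.ofReal_add hα5.le hα5.le, ← ENNReal.ofReal_add (by positivity) hα5.le,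
      ← ENNReal.ofReal_add (by positivity) hα5.le, ← ENNReal.ofReal_add (by positivity) hα5.le]
    exact ENNReal.ofReal_le_ofReal (by linarith)

end Tails

/-! ### Feasibility and bias of the squared filter -/

section Oracle

lemma l2Norm_le_of_forall_le {n : ℕ} {f : Signal} {D : ℝ} (hD : 0 ≤ D)
    (h : ∀ t ∈ Finset.range (n + 1), ‖f (t : ℤ)‖ ≤ D) : l2Norm n f ≤ √((n : ℝ) + 1) * D := by
  rw [l2Norm, Real.sqrt_le_left (by positivity), mul_pow, Real.sq_sqrt (by positivity)]
  calc _ ≤ ∑ t ∈ Finset.range (n + 1), D ^ 2 :=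
        Finset.sum_le_sum fun t ht => pow_le_pow_left₀ (norm_nonneg _) (h t ht) 2
    _ = _ := by simp

/-- The squared oracle filter is feasible and reproduces the signal. -/
lemma oracle_filter {m n : ℕ} (hn : n = 2 * m) {σ ρ : ℝ} (hσ : 0 < σ) (hρ : 1 ≤ ρ) {x φ : Signal}
    (hφ : SupportedOn m φ) (h2 : 2 * ((m : ℝ) + 1) * l2Norm m φ ^ 2 ≤ ρ ^ 2)
    (hx : ∀ τ ∈ Set.Icc (-(m : ℤ)) (2 * m), ‖x τ - conv φ x τ‖ ≤ σ * ρ / √((m : ℝ) + 1)) :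
    SupportedOn n (conv φ φ) ∧ specL1 n (conv φ φ) ≤ ρ ^ 2 / √((n : ℝ) + 1) ∧
      l2Norm n (x - conv (conv φ φ) x) ≤ 3 * σ * ρ ^ 2 := by
  subst hn
  have hm : (0 : ℝ) < (m : ℝ) + 1 := by positivity
  refine ⟨supportedOn_conv_self hφ, ?_, ?_⟩
  · rw [specL1_conv_self hφ, le_div_iff₀ (by positivity), mul_right_comm,
      Real.mul_self_sqrt (by positivity)]
    push_cast
    nlinarith [sq_nonneg (l2Norm m φ)]
  · set D := σ * ρ / √((m : ℝ) + 1) with hD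
    have hD0 : 0 ≤ D := by positivity
    have hl1 : ∑ j ∈ Finset.range (m + 1), ‖φ (j : ℤ)‖ ≤ ρ := by
      have h3 := sq_sum_le_card_mul_sum_sq (s := Finset.range (m + 1))
        (f := fun j : ℕ => ‖φ (j : ℤ)‖)
      rw [l2Norm, Real.sq_sqrt (by positivity)] at h2
      rw [Finset.card_range] at h3
      push_cast at h3
      refine abs_le_of_sq_le_sq' ?_ (by positivity) |>.2
      have : 0 ≤ ((m : ℝ) + 1) * ∑ t ∈ Finset.range (m + 1), ‖φ (t : ℤ)‖ ^ 2 := by positivity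
      linarith
    have hpt : ∀ t ∈ Finset.range (2 * m + 1), ‖(x - conv (conv φ φ) x) (t : ℤ)‖ ≤ 2 * ρ * D := by
      intro t ht
      rw [Finset.mem_range] at ht
      -- This is `1 - φ² = (1 - φ) + φ(1 - φ)`. The second term reads the bias at times `t - j ≥
      -- -m`, which is why simplicity is required from `-m` on.
      have e : (x - conv (conv φ φ) x) (t : ℤ) = (x t - conv φ x t) +
          ∑ j ∈ Finset.range (m + 1), φ j * (x (t - j) - conv φ x (t - j)) := by
        rw [Pi.sub_apply, conv_conv_self hφ, conv_eq_sum hφ (conv φ x)]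
        simp_rw [mul_sub]
        rw [Finset.sum_sub_distrib, ← conv_eq_sum hφ x]
        ring
      rw [e]
      calc _ ≤ D + ∑ j ∈ Finset.range (m + 1), ‖φ (j : ℤ)‖ * D := by
            refine (norm_add_le _ _).trans (add_le_add (hx t ?_) ?_)
            · constructor <;> omega
            · refine (norm_sum_le _ _).trans (Finset.sum_le_sum fun j hj => ?_)
              rw [Finset.mem_range] at hj
              rw [norm_mul]
              refine mul_le_mul_of_nonneg_left (hx _ ?_) (norm_nonneg _)
              constructor <;> omega
        _ ≤ D + ρ * D := by
            rw [← Finset.sum_mul]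
            gcongr
        _ ≤ 2 * ρ * D := by nlinarith
    refine (l2Norm_le_of_forall_le (by positivity) hpt).trans ?_
    have h4 : √(((2 * m : ℕ) : ℝ) + 1) ≤ 3 / 2 * √((m : ℝ) + 1) := by
      rw [Real.sqrt_le_left (by positivity), mul_pow, Real.sq_sqrt hm.le]
      push_cast
      linarith
    calc _ ≤ 3 / 2 * √((m : ℝ) + 1) * (2 * ρ * D) := by gcongr
      _ = 3 * σ * ρ ^ 2 := by
        rw [hD]
        have : √((m : ℝ) + 1) ≠ 0 := by positivity
        field_simp

end Oracle

/-! ### Numerical estimates for the logarithmic terms -/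

section Numerics

lemma log_two_add_log_le {α : ℝ} (hα : 0 < α) (hα1 : α ≤ 1) :
    Real.log 2 + Real.log (1 / (α / 5)) ≤ 3 * (1 + Real.log (1 / α)) := by
  have h0 : 0 ≤ Real.log (1 / α) := Real.log_nonneg (by rw [le_div_iff₀ hα]; linarith)
  have e : Real.log 2 + Real.log (1 / (α / 5)) = Real.log 10 + Real.log (1 / α) := by
    rw [← Real.log_mul (by norm_num) (by positivity), ← Real.log_mul (by norm_num) (by positivity)]
    congr 1
    field_simp
    norm_num
  have h10 : Real.log 10 ≤ 3 := by
    rw [Real.log_le_iff_le_exp (by norm_num)]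
    have := Real.add_one_le_exp 1
    have h3 : Real.exp 3 = Real.exp 1 ^ 3 := by
      rw [← Real.exp_nat_mul]
      norm_num
    have he := Real.exp_one_gt_d9
    have : (2.7 : ℝ) ^ 3 ≤ Real.exp 1 ^ 3 := pow_le_pow_left₀ (by norm_num) (by linarith) 3
    rw [h3]
    norm_num at this ⊢
    linarith
  linarith

/-- Since `n ≥ 2`, constants are absorbed in powers of `n`: `2 ^ (p + 1) ≤ n ^ 4` and `30 (n + 1) ^
2 ≤ n ^ 9`. Then `22 = 4 + 2 · 9` and `176 = 4 · 2 · 22`. -/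
lemma blockBound_le {n p : ℕ} (hn : 2 ≤ n) (hp : 2 ^ p ≤ 2 * (n + 1)) {α : ℝ} (hα : 0 < α)
    (hα1 : α ≤ 1) :
    4 * 2 ^ p * ((p + 1) * Real.log 2 + 2 * Real.log (1 / (α / (30 * ((n : ℝ) + 1) ^ 2)))) ≤
      176 * ((n : ℝ) + 1) * Real.log (n / α) := by
  have hn' : (2 : ℝ) ≤ n := by exact_mod_cast hn
  have hn0 : (0 : ℝ) < n := by linarith
  have h0 : 0 ≤ Real.log (1 / α) := Real.log_nonneg (by rw [le_div_iff₀ hα]; linarith)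
  have hln : 0 ≤ Real.log n := Real.log_nonneg (by linarith)
  have hΛ : Real.log (n / α) = Real.log n + Real.log (1 / α) := by
    rw [← Real.log_mul hn0.ne' (by positivity), mul_one_div]
  have hp' : (2 : ℝ) ^ p ≤ 2 * ((n : ℝ) + 1) := by exact_mod_cast hp
  have h1 : (p + 1) * Real.log 2 ≤ 4 * Real.log n := by
    have : Real.log (2 ^ (p + 1)) ≤ Real.log ((n : ℝ) ^ 4) := by
      refine Real.log_le_log (by positivity) ?_
      rw [pow_succ]
      have : (8 : ℝ) ≤ (n : ℝ) ^ 3 := by nlinarith [pow_le_pow_left₀ (by norm_num) hn' 3]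
      nlinarith
    rw [Real.log_pow, Real.log_pow] at this
    exact_mod_cast this
  have h2 : Real.log (1 / (α / (30 * ((n : ℝ) + 1) ^ 2))) ≤ 9 * Real.log n + Real.log (1 / α) := by
    have e : 1 / (α / (30 * ((n : ℝ) + 1) ^ 2)) = (30 * ((n : ℝ) + 1) ^ 2) * (1 / α) := by
      field_simp
    rw [e, Real.log_mul (by positivity) (by positivity)]
    have : Real.log (30 * ((n : ℝ) + 1) ^ 2) ≤ Real.log ((n : ℝ) ^ 9) := by
      refine Real.log_le_log (by positivity) ?_
      have h7 : (128 : ℝ) ≤ (n : ℝ) ^ 7 := by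
        have := pow_le_pow_left₀ (by norm_num) hn' 7
        norm_num at this
        exact this
      calc 30 * ((n : ℝ) + 1) ^ 2 ≤ 128 * (n : ℝ) ^ 2 := by nlinarith
        _ ≤ (n : ℝ) ^ 7 * (n : ℝ) ^ 2 := by gcongr
        _ = (n : ℝ) ^ 9 := by ring
    rw [Real.log_pow] at this
    push_cast at this
    linarith
  rw [hΛ]
  calc _ ≤ 4 * (2 * ((n : ℝ) + 1)) * (22 * (Real.log n + Real.log (1 / α))) := by
        have h3 : 0 ≤ Real.log (1 / (α / (30 * ((n : ℝ) + 1) ^ 2))) := by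
          refine Real.log_nonneg ?_
          rw [le_div_iff₀ (by positivity), one_mul, div_le_one (by positivity)]
          nlinarith
        have h4 : 0 ≤ (p + 1) * Real.log 2 := by positivity
        refine mul_le_mul (by linarith) (by linarith) (by linarith) (by positivity)
    _ = _ := by ring

end Numerics

/-! ### Recovery for a regular realization of the noise -/

section Recovery

variable {n : ℕ}

lemma l2Norm_congr {f g : Signal} (h : ∀ t ∈ Finset.range (n + 1), f (t : ℤ) = g (t : ℤ)) :
    l2Norm n f = l2Norm n g := by
  rw [← norm_window, ← norm_window, window_congr h]

/-- On the window, filters supported on `[0, n]` read observed entries only. This permits replacing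
the unspecified noise outside `[-n, n]` by zero. -/
lemma conv_obs_congr {ψ : Signal} (hψ : SupportedOn n ψ) {v w : Signal}
    (h : ∀ i : ObsIdx n, v i = w i) {t : ℕ} (ht : t ∈ Finset.range (n + 1)) :
    conv ψ v t = conv ψ w t := by
  rw [Finset.mem_range] at ht
  rw [conv_eq_sum_obsIdx hψ v (n := n) (by omega) (by omega),
    conv_eq_sum_obsIdx hψ w (n := n) (by omega) (by omega)]
  exact Finset.sum_congr rfl fun i _ => by rw [h]

lemma l2Norm_add_le (f g : Signal) : l2Norm n (f + g) ≤ l2Norm n f + l2Norm n g := by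
  simpa only [← norm_window, map_add] using norm_add_le _ _

lemma l2Norm_smul (c : ℂ) (f : Signal) : l2Norm n (c • f) = ‖c‖ * l2Norm n f := by
  simp only [← norm_window, map_smul, norm_smul]

/-- Uniform control of the noise against the residuals of feasible filters. -/
lemma IsRegularNoise.norm_inner_residual_le {p s : ℕ} (hn : 2 ≤ n) (hp : n + 1 ≤ 2 ^ p)
    (hp2 : 2 ^ p ≤ 2 * (n + 1)) {σ r ϰ α : ℝ} (hσ : 0 < σ) (hr : 2 ≤ r)
    (hα : 0 < α) (hα1 : α ≤ 1) (hϰ : 0 ≤ ϰ)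
    {S : Submodule ℂ Signal} (hS : S.map shift = S) {xS ε φ₀ ψ : Signal} (hxS : xS ∈ S)
    {z : ObsIdx n → ℂ}
    (hz : IsRegularNoise (S.map (window n)) s p φ₀ ε (σ * ϰ) α
      (4 * 2 ^ p * ((p + 1) * Real.log 2 + 2 * Real.log (1 / (α / (30 * ((n : ℝ) + 1) ^ 2))))) z)
    (hψ : ψ ∈ feasible n r) :
    ‖inner ℂ (WithLp.toLp 2 z) (window n (xS + ε - conv ψ (xS + ε + (σ : ℂ) • extend z)))‖ ≤
      ‖(S.map (window n)).starProjection (WithLp.toLp 2 z)‖ *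
        l2Norm n (xS + ε - conv ψ (xS + ε + (σ : ℂ) • extend z)) +
      1056 * σ * (r * (ϰ * √(1 + Real.log (1 / α)) + Real.log (n / α))) := by
  obtain ⟨hψ, hψr⟩ := hψ
  have h1 := norm_inner_window_residual_le hS (ε := ε) hxS hσ.le hψ z
  set Λ := Real.log (n / α) with hΛ
  set Λ₁ := 1 + Real.log (1 / α) with hΛ₁
  set q := (S.map (window n))ᗮ.starProjection (WithLp.toLp 2 z) with hq
  have hN : (0 : ℝ) < (n : ℝ) + 1 := by positivity
  have hsqN : 0 < √((n : ℝ) + 1) := Real.sqrt_pos.2 hN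
  have hsqN2 : √((n : ℝ) + 1) * √((n : ℝ) + 1) = (n : ℝ) + 1 := Real.mul_self_sqrt hN.le
  have hn' : (2 : ℝ) ≤ n := by exact_mod_cast hn
  have hlogα : 0 ≤ Real.log (1 / α) := Real.log_nonneg (by rw [le_div_iff₀ hα]; linarith)
  have hsqΛ : √Λ₁ ^ 2 = Λ₁ := Real.sq_sqrt (by linarith)
  have hΛ0 : 0 ≤ Λ := Real.log_nonneg (by rw [le_div_iff₀ hα]; linarith)
  have hlog := log_two_add_log_le hα hα1
  have hspec0 : 0 ≤ specL1 n ψ := Finset.sum_nonneg fun _ _ => norm_nonneg _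
  have hb : (4 * (σ * ϰ) * √Λ₁) ^ 2 = 16 * (σ * ϰ) ^ 2 * Λ₁ := by
    rw [mul_pow, hsqΛ]
    ring
  have hc : 4 * (σ * ϰ) ^ 2 * (Real.log 2 + Real.log (1 / (α / 5))) ≤
      (4 * (σ * ϰ) * √Λ₁) ^ 2 := by
    rw [hb]
    calc _ ≤ 4 * (σ * ϰ) ^ 2 * (3 * Λ₁) := by gcongr
      _ ≤ _ := by
        have : 0 ≤ (σ * ϰ) ^ 2 * Λ₁ := by positivity
        linarith
  have hE : ‖inner ℂ q (window n ε)‖ ≤ 4 * (σ * ϰ) * √Λ₁ :=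
    abs_le_of_sq_le_sq' (hz.error.trans hc) (by positivity) |>.2
  have h2 : ‖inner ℂ q (window n (conv ψ ε))‖ ≤ r * (4 * (σ * ϰ) * √Λ₁) := by
    refine (norm_inner_window_conv_le hψ ε q hz.shifts).trans ?_
    calc _ ≤ r / √((n : ℝ) + 1) * (4 * (σ * ϰ) * √Λ₁ * √((n : ℝ) + 1)) := by
          refine mul_le_mul hψr ?_ (Real.sqrt_nonneg _) (by positivity)
          rw [Real.sqrt_le_left (by positivity), mul_pow _ (√((n : ℝ) + 1)), Real.sq_sqrt hN.le,
            mul_right_comm]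
          exact mul_le_mul_of_nonneg_right hc hN.le
      _ = _ := by field_simp
  have h3 : ‖inner ℂ q (window n (conv ψ (extend z)))‖ ≤ 1056 * (r * Λ) := by
    refine (norm_inner_window_conv_extend_le hψ z q hp (fun k hk => (hz.blocks k hk).1)
      (fun k hk => (hz.blocks k hk).2.1) (fun k hk => (hz.blocks k hk).2.2)).trans ?_
    rw [div_le_iff₀ hsqN]
    calc _ ≤ 6 * (176 * ((n : ℝ) + 1) * Λ) * (r / √((n : ℝ) + 1)) := by
          refine mul_le_mul ?_ hψr hspec0 (by positivity)
          exact mul_le_mul_of_nonneg_left (blockBound_le hn hp2 hα hα1) (by norm_num)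
      _ = _ := by
          rw [mul_div_assoc', div_eq_iff hsqN.ne']
          linear_combination (-(1056 * r * Λ)) * hsqN2
  have h5 : σ * ‖inner ℂ q (window n (conv ψ (extend z)))‖ ≤ σ * (1056 * (r * Λ)) :=
    mul_le_mul_of_nonneg_left h3 hσ.le
  have h6 : 0 ≤ σ * ϰ * √Λ₁ := by positivity
  -- As `r ≥ 2`, the term coming from `ε` alone is absorbed in the one coming from `ψ * ε`; both
  -- stay far below the constant `1056 = 6 · 176` of the quadratic term.
  have h7 : 2 * (σ * ϰ * √Λ₁) ≤ r * (σ * ϰ * √Λ₁) := mul_le_mul_of_nonneg_right hr h6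
  linarith

/-- Accuracy of the recovery by the oracle filter. -/
lemma IsRegularNoise.oracle_le {p s : ℕ} {σ ρ c α B : ℝ} (hσ : 0 < σ)
    (hα : 0 < α) (hα1 : α ≤ 1) {V : Submodule ℂ (EuclideanSpace ℂ (ObsIdx n))}
    {x ε φ₀ : Signal} (hφ₀ : SupportedOn n φ₀) (hspec : specL1 n φ₀ ≤ ρ ^ 2 / √((n : ℝ) + 1))
    (hrec : l2Norm n (x - conv φ₀ x) ≤ 3 * σ * ρ ^ 2) {z : ObsIdx n → ℂ}
    (hz : IsRegularNoise V s p φ₀ ε c α B z) :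
    l2Norm n (x - conv φ₀ (x + (σ : ℂ) • extend z)) ≤
      7 * σ * ρ ^ 2 * √(1 + Real.log (1 / α)) := by
  set Λ₁ := 1 + Real.log (1 / α) with hΛ₁
  have hN : (0 : ℝ) < (n : ℝ) + 1 := by positivity
  have hlogα : 0 ≤ Real.log (1 / α) := Real.log_nonneg (by rw [le_div_iff₀ hα]; linarith)
  have hsqΛ : √Λ₁ ^ 2 = Λ₁ := Real.sq_sqrt (by linarith)
  have hsq1 : 1 ≤ √Λ₁ := Real.one_le_sqrt.2 (by linarith)
  have hlog := log_two_add_log_le hα hα1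
  have hconv₀ : l2Norm n (conv φ₀ (extend z)) ≤ 4 * ρ ^ 2 * √Λ₁ := by
    refine abs_le_of_sq_le_sq' ?_ (by positivity) |>.2
    refine hz.filtered.trans ?_
    have h1 : l2Norm n φ₀ ^ 2 * (n + 1) ≤ (ρ ^ 2) ^ 2 := by
      have := pow_le_pow_left₀ (Real.sqrt_nonneg _) ((l2Norm_le_specL1 n φ₀).trans hspec) 2
      rwa [div_pow, Real.sq_sqrt hN.le, le_div_iff₀ hN] at this
    have hb : (4 * ρ ^ 2 * √Λ₁) ^ 2 = 16 * (ρ ^ 2) ^ 2 * Λ₁ := by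
      rw [mul_pow, hsqΛ]
      ring
    rw [hb]
    calc _ = 4 * (l2Norm n φ₀ ^ 2 * (n + 1)) * (Real.log 2 + Real.log (1 / (α / 5))) := by ring
      _ ≤ 4 * (l2Norm n φ₀ ^ 2 * (n + 1)) * (3 * Λ₁) :=
        mul_le_mul_of_nonneg_left hlog (by positivity)
      _ ≤ 4 * (ρ ^ 2) ^ 2 * (3 * Λ₁) :=
        mul_le_mul_of_nonneg_right (by linarith) (by positivity)
      _ ≤ _ := by
        have : 0 ≤ (ρ ^ 2) ^ 2 * Λ₁ := by positivity
        linarith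
  have e : x - conv φ₀ (x + (σ : ℂ) • extend z) = (x - conv φ₀ x) +
      (-(σ : ℂ)) • conv φ₀ (extend z) := by
    rw [conv_add_right hφ₀, conv_smul_right hφ₀, neg_smul]
    abel
  rw [e]
  refine (l2Norm_add_le _ _).trans ?_
  rw [l2Norm_smul, norm_neg, Complex.norm_real, Real.norm_of_nonneg hσ.le]
  have h1 : σ * l2Norm n (conv φ₀ (extend z)) ≤ σ * (4 * ρ ^ 2 * √Λ₁) := by gcongr
  have h2 : 3 * σ * ρ ^ 2 * 1 ≤ 3 * σ * ρ ^ 2 * √Λ₁ := by gcongr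
  linarith

set_option maxHeartbeats 800000 in
/-- Recovery bound for one regular realization of the noise. -/
lemma recovery_of_isRegularNoise {p s : ℕ} (hn : 2 ≤ n) (hs : 1 ≤ s) (hp : n + 1 ≤ 2 ^ p)
    (hp2 : 2 ^ p ≤ 2 * (n + 1)) {σ ρ r ϰ α : ℝ} (hσ : 0 < σ) (hρ : 1 ≤ ρ) (hr : 2 * ρ ^ 2 ≤ r)
    (hα : 0 < α) (hα1 : α ≤ 1) (hϰ : 0 ≤ ϰ)
    {S : Submodule ℂ Signal} (hS : S.map shift = S) {xS ε φ₀ φ : Signal} (hxS : xS ∈ S)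
    (hφ₀ : SupportedOn n φ₀) (hspec : specL1 n φ₀ ≤ ρ ^ 2 / √((n : ℝ) + 1))
    (hrec : l2Norm n (xS + ε - conv φ₀ (xS + ε)) ≤ 3 * σ * ρ ^ 2) {z : ObsIdx n → ℂ}
    (hz : IsRegularNoise (S.map (window n)) s p φ₀ ε (σ * ϰ) α
      (4 * 2 ^ p * ((p + 1) * Real.log 2 + 2 * Real.log (1 / (α / (30 * ((n : ℝ) + 1) ^ 2))))) z)
    (hφ : IsConstrainedFilter n r (xS + ε + (σ : ℂ) • extend z) φ) :
    l2Norm n (xS + ε - conv φ (xS + ε + (σ : ℂ) • extend z)) ≤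
      7 * σ * ρ ^ 2 * √(1 + Real.log (1 / α)) +
        74 * σ * √(s + r * (ϰ * √(1 + Real.log (1 / α)) + Real.log (n / α))) := by
  have hr2 : 2 ≤ r := by nlinarith
  have hfeas₀ : φ₀ ∈ feasible n r := by
    refine ⟨hφ₀, hspec.trans (div_le_div_of_nonneg_right ?_ (Real.sqrt_nonneg _))⟩
    nlinarith [sq_nonneg ρ]
  have hunif := fun ψ (hψ : ψ ∈ feasible n r) =>
    hz.norm_inner_residual_le hn hp hp2 hσ hr2 hα hα1 hϰ hS hxS hψ
  have he₀ := hz.oracle_le hσ hα hα1 hφ₀ hspec hrec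
  have hproj := hz.proj
  clear hz hrec hspec
  set y := xS + ε + (σ : ℂ) • extend z with hy
  set Λ := Real.log (n / α) with hΛ
  set Λ₁ := 1 + Real.log (1 / α) with hΛ₁
  set X := s + r * (ϰ * √Λ₁ + Λ) with hX
  set A := ‖(S.map (window n)).starProjection (WithLp.toLp 2 z)‖ with hA
  have hn' : (2 : ℝ) ≤ n := by exact_mod_cast hn
  have hs' : (1 : ℝ) ≤ s := by exact_mod_cast hs
  have hlogα : 0 ≤ Real.log (1 / α) := Real.log_nonneg (by rw [le_div_iff₀ hα]; linarith)
  have hΛα : Real.log (1 / α) ≤ Λ := Real.log_le_log (by positivity) (by gcongr; linarith)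
  have hΛ0 : 0 ≤ Λ := hlogα.trans hΛα
  have hX1 : s + Λ ≤ X := by
    have h1 : 0 ≤ r * (ϰ * √Λ₁) := by positivity
    have h2 : 1 * Λ ≤ r * Λ := mul_le_mul_of_nonneg_right (by linarith) hΛ0
    rw [hX]
    linarith
  have hX0 : 0 ≤ X := by linarith
  -- Here `s log 2 + log (5/α) ≤ (s - 1) + 3(1 + log (1/α))`, which is at most `3X` because `s ≥ 1`.
  have hP : A ≤ 4 * √X := by
    refine abs_le_of_sq_le_sq' ?_ (by positivity) |>.2
    rw [mul_pow, Real.sq_sqrt hX0]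
    refine hproj.trans ?_
    have hlog := log_two_add_log_le hα hα1
    have hl2 : Real.log 2 ≤ 1 := Real.log_two_lt_d9.le.trans (by norm_num)
    have hl2' : 0 ≤ Real.log 2 := Real.log_nonneg one_le_two
    have : (s - 1 : ℝ) * Real.log 2 ≤ s - 1 := mul_le_of_le_one_right (by linarith) hl2
    linarith
  set R := 1056 * σ * (r * (ϰ * √Λ₁ + Λ)) with hR
  have hR0 : 0 ≤ R := by positivity
  have hopt : ‖window n (xS + ε - conv φ y) + (σ : ℂ) • window n (extend z)‖ ≤
      ‖window n (xS + ε - conv φ₀ y) + (σ : ℂ) • window n (extend z)‖ := by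
    have e : ∀ ψ : Signal, window n (xS + ε - conv ψ y) + (σ : ℂ) • window n (extend z) =
        window n (y - conv ψ y) := by
      intro ψ
      rw [← map_smul, ← map_add, hy]
      congr 1
      abel
    rw [e, e, norm_window, norm_window]
    exact hφ.2 hfeas₀
  have hunif' : ∀ ψ ∈ feasible n r, ‖inner ℂ (window n (extend z))
      (window n (xS + ε - conv ψ y))‖ ≤ A * ‖window n (xS + ε - conv ψ y)‖ + R := by
    intro ψ hψ
    rw [inner_window_extend, norm_window]
    exact hunif ψ hψ
  have hfin := norm_le_of_residual_le hσ.le (norm_nonneg _) hR0 hopt (hunif' φ hφ.1)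
    (hunif' φ₀ hfeas₀)
  rw [norm_window, norm_window] at hfin
  -- The constant works because `33² = 1089 ≥ 1056`.
  have hsR : √(σ * R) ≤ 33 * σ * √X := by
    rw [Real.sqrt_le_left (by positivity), mul_pow, mul_pow, Real.sq_sqrt hX0, hR]
    have h1 : r * (ϰ * √Λ₁ + Λ) ≤ X := by linarith
    have h2 : σ ^ 2 * (r * (ϰ * √Λ₁ + Λ)) ≤ σ ^ 2 * X := by gcongr
    have h3 : 0 ≤ σ ^ 2 * X := by positivity
    linarith
  have hAX : σ * A ≤ σ * (4 * √X) := mul_le_mul_of_nonneg_left hP hσ.le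
  linarith

end Recovery

end FilterRecovery

theorem mainTheorem4 :
    ∃ C C' : ℝ, 0 < C ∧ 0 < C' ∧
      ∀ (Ω : Type*) [MeasurableSpace Ω] (P : Measure Ω) [IsProbabilityMeasure P]
        (m n s : ℕ) (σ ρ r ϰ α : ℝ) (x : FilterRecovery.Signal) (ζ : ℤ → Ω → ℂ),
        1 ≤ m → n = 2 * m → 0 < σ → 1 ≤ ρ → 2 * ρ ^ 2 ≤ r → 0 < α → α ≤ 1 →
        FilterRecovery.IsNoise P n ζ →
        FilterRecovery.IsSimpleSignal P σ ζ m ρ x →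
        FilterRecovery.AssumptionA n σ s ϰ x →
        ∃ E : Set Ω, MeasurableSet E ∧ 1 - α ≤ P.real E ∧
          ∀ ω ∈ E, ∀ φ : FilterRecovery.Signal,
            FilterRecovery.IsConstrainedFilter n r (FilterRecovery.obs σ x ζ ω) φ →
            FilterRecovery.l2Norm n (x - FilterRecovery.conv φ (FilterRecovery.obs σ x ζ ω)) ≤
              C * σ * ρ ^ 2 * Real.sqrt (1 + Real.log (1 / α)) +
              C' * σ * Real.sqrt
                (s + r * (ϰ * Real.sqrt (1 + Real.log (1 / α)) + Real.log (n / α))) := by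
  open FilterRecovery in
  -- `7 = 3 + 4` adds bias and filtered noise of the oracle; `74 = 2 · 4 + 2 · 33` comes from `2σA +
  -- 2√(σR)`.
  refine ⟨7, 74, by norm_num, by norm_num, ?_⟩
  intro Ω _ P _ m n s σ ρ r ϰ α x ζ hm hn hσ hρ hr hα hα1 hζ hx hA
  obtain ⟨φo, hφo, hφo2, hφox⟩ := hx.exists_filter hn hζ hσ (zero_le_one.trans hρ)
  obtain ⟨hs1, -, S, hS, hSs, xS, ε, hxS, rfl, hε⟩ := hA
  obtain ⟨hφ₀, hspec, hrec⟩ := oracle_filter hn hσ hρ hφo hφo2 hφox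
  have hn2 : 2 ≤ n := by omega
  have hϰ : 0 ≤ ϰ := by
    have := (Real.sqrt_nonneg _).trans (hε 0 (Nat.zero_le _))
    exact nonneg_of_mul_nonneg_right this hσ
  set p := Nat.clog 2 (n + 1) with hpdef
  have hp : n + 1 ≤ 2 ^ p := Nat.le_pow_clog one_lt_two _
  have hp2 : 2 ^ p ≤ 2 * (n + 1) := by
    have h1 : 2 ^ p.pred < n + 1 := Nat.pow_pred_clog_lt_self one_lt_two (by omega)
    have h2 : 0 < p := Nat.clog_pos one_lt_two (by omega)
    have h3 : 2 ^ p = 2 * 2 ^ p.pred := by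
      rw [← pow_succ']
      congr 1
      exact (Nat.succ_pred_eq_of_pos h2).symm
    omega
  have hp1 : p + 1 ≤ 2 * (n + 1) := (Nat.lt_two_pow_self (n := p)).trans_le hp2
  -- `finrank` is `0` by default in infinite dimension, so `s ≥ 1` is what makes `S`
  -- finite-dimensional.
  have hfin : FiniteDimensional ℂ S := Module.finite_of_finrank_pos (by omega)
  have hVs : Module.finrank ℂ (S.map (window n)) ≤ s := hSs ▸ Submodule.finrank_map_le _ _
  set B : ℝ := 4 * 2 ^ p * ((p + 1) * Real.log 2 +
    2 * Real.log (1 / (α / (30 * ((n : ℝ) + 1) ^ 2)))) with hB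
  have hmeas := measure_not_isRegularNoise (S.map (window n)) hVs hp1 hφ₀ hε hα hα1
  set Z : Ω → ObsIdx n → ℂ := fun ω i => ζ i ω with hZ
  set bad : Set Ω := Z ⁻¹' {z | ¬ IsRegularNoise (S.map (window n)) s p (conv φo φo) ε (σ * ϰ) α
    B z} with hbad
  have hPbad : P bad ≤ ENNReal.ofReal α := by
    refine (Measure.le_map_apply hζ.hasLaw.aemeasurable _).trans ?_
    rw [hζ.hasLaw.map_eq]
    exact hmeas
  -- The bad set is only bounded in outer measure; its measurable hull has the same measure, and the
  -- complement of the hull is the required event.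
  refine ⟨(toMeasurable P bad)ᶜ, (measurableSet_toMeasurable _ _).compl, ?_, ?_⟩
  · rw [probReal_compl_eq_one_sub (measurableSet_toMeasurable _ _), measureReal_def,
      measure_toMeasurable]
    have := ENNReal.toReal_le_of_le_ofReal hα.le hPbad
    linarith
  · intro ω hω φ hφ
    have hreg : IsRegularNoise (S.map (window n)) s p (conv φo φo) ε (σ * ϰ) α B (Z ω) := by
      by_contra hcon
      exact hω (subset_toMeasurable _ _ hcon)
    set y := xS + ε + (σ : ℂ) • extend (Z ω) with hy
    have hyobs : ∀ i : ObsIdx n, obs σ (xS + ε) ζ ω i = y i := by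
      intro i
      simp only [obs, hy, Pi.add_apply, Pi.smul_apply, smul_eq_mul, extend_apply, hZ]
    have hy' : ∀ ψ, SupportedOn n ψ →
        l2Norm n (obs σ (xS + ε) ζ ω - conv ψ (obs σ (xS + ε) ζ ω)) = l2Norm n (y - conv ψ y) := by
      intro ψ hψ
      refine l2Norm_congr fun t ht => ?_
      rw [Pi.sub_apply, Pi.sub_apply, conv_obs_congr hψ hyobs ht,
        hyobs ⟨t, mem_obs_of_mem_range ht⟩]
    have hφ' : IsConstrainedFilter n r y φ := by
      refine ⟨hφ.1, fun ψ hψ => ?_⟩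
      have := hφ.2 hψ
      simp only [Set.mem_ofPred_eq] at this ⊢
      rwa [hy' φ hφ.1.1, hy' ψ hψ.1] at this
    have e : l2Norm n (xS + ε - conv φ (obs σ (xS + ε) ζ ω)) = l2Norm n (xS + ε - conv φ y) := by
      refine l2Norm_congr fun t ht => ?_
      rw [Pi.sub_apply, Pi.sub_apply, conv_obs_congr hφ.1.1 hyobs ht]
    rw [e]
    exact recovery_of_isRegularNoise hn2 hs1 hp hp2 hσ hρ hr hα hα1 hϰ hS hxS hφ₀ hspec hrec hreg hφ'
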